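/- Manifolds are smooth, Hausdorff, second countable, without boundary and of pure dimension. A locally conformal symplectic form on a manifold $M$ is a smooth nondegenerate $2$-form $\Omega$ for which there is a smooth closed $1$-form $\omega$, called a Lee form of $\Omega$, with $d\Omega=\omega\wedge\Omega$; then $(M,\Omega,\omega)$ is called a locally conformal symplectic manifold if moreover $\dim M=2n>2$. Let $\iota:Q\hookrightarrow M$ be an (injectively immersed) submanifold of a locally conformal symplectic manifold $(M,\Omega,\omega)$. For $q\in Q$ put $(T_qQ)^\Omega=\{v\in T_qM:\ \Omega(v,w)=0\ \text{for all } w\in T_qQ\}$ and assume that the dimension of $(T_qQ)^\Omega\cap T_qQ$ does not depend on $q$. The distribution $TQ^\Omega\cap TQ$ is then integrable; let $\mathcal F$ be the foliation of $Q$ tangent to it (the characteristic foliation), whose leaves are the maximal connected integral manifolds of $TQ^\Omega\cap TQ$. Let $\Omega^p(Q)$ be the space of smooth $p$-forms on $Q$, let $\Omega^p(Q,\mathcal F)$ be the subspace of the forms that vanish on all $p$-tuples of vectors tangent to $\mathcal F$, and put $\Omega^p(\mathcal F)=\Omega^p(Q)/\Omega^p(Q,\mathcal F)$. The exterior derivative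 induces a differential on $\Omega^\bullet(\mathcal F)$, and $H^1(\mathcal F)$ denotes the first cohomology of this complex. The closed form $\iota^*\omega$ has a class $[\iota^*\omega]\in H^1(\mathcal F)$. **Theorem.** Suppose that the leaf space $N=Q/\mathcal F$ is a manifold of dimension greater than $2$ and that the canonical projection $\pi:Q\to N$ is a submersion. Then there exist a locally conformal symplectic form $\tau$ on $N$ and a smooth positive function $f$ on $Q$ such that $$\pi^*\tau=f\,\iota^*\Omega$$ if and only if $[\iota^*\omega]=0$ in $H^1(\mathcal F)$. -/

import Mathlib

open scoped Manifold ContDiff Topology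

noncomputable section

namespace LCSReduction

universe u

section Forms

variable {E : Type*} [NormedAddCommGroup E] [NormedSpace ℝ E]
  {E' : Type*} [NormedAddCommGroup E'] [NormedSpace ℝ E']

/-- Differential `k`-forms (not necessarily smooth) on a manifold `M` without boundary modelled
on `E`: an alternating `k`-linear form on each tangent space. -/
def DiffForm (E : Type*) [NormedAddCommGroup E] [NormedSpace ℝ E] (M : Type*)
    [TopologicalSpace M] [ChartedSpace E M] (k : ℕ) : Type _ :=
  (x : M) → TangentSpace 𝓘(ℝ, E) x [⋀^Fin k]→L[ℝ] ℝ

instance (E : Type*) [NormedAddCommGroup E] [NormedSpace ℝ E] (M : Type*)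
    [TopologicalSpace M] [ChartedSpace E M] (k : ℕ) : AddCommGroup (DiffForm E M k) :=
  inferInstanceAs (AddCommGroup ((x : M) → TangentSpace 𝓘(ℝ, E) x [⋀^Fin k]→L[ℝ] ℝ))

instance (E : Type*) [NormedAddCommGroup E] [NormedSpace ℝ E] (M : Type*)
    [TopologicalSpace M] [ChartedSpace E M] (k : ℕ) : Module ℝ (DiffForm E M k) :=
  inferInstanceAs (Module ℝ ((x : M) → TangentSpace 𝓘(ℝ, E) x [⋀^Fin k]→L[ℝ] ℝ))

variable {M : Type*} [TopologicalSpace M] [ChartedSpace E M]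
  {Q : Type*} [TopologicalSpace Q] [ChartedSpace E' Q] {k : ℕ}

/-- The pullback `f^* α`. -/
def pullback (f : Q → M) (α : DiffForm E M k) : DiffForm E' Q k := fun q =>
  (α (f q)).compContinuousLinearMap (mfderiv 𝓘(ℝ, E') 𝓘(ℝ, E) f q)

/-- The form `α` written in the preferred chart at `x`, i.e. the pullback of `α` by the inverse of
that chart; it is meaningful on the target of the chart. -/
def inChart (α : DiffForm E M k) (x : M) : E → E [⋀^Fin k]→L[ℝ] ℝ := fun y =>
  (α ((extChartAt 𝓘(ℝ, E) x).symm y)).compContinuousLinearMap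
    (mfderiv 𝓘(ℝ, E) 𝓘(ℝ, E) (extChartAt 𝓘(ℝ, E) x).symm y)

/-- A form is smooth if it is smooth in charts. -/
def IsSmoothForm (α : DiffForm E M k) : Prop :=
  ∀ x : M, ContDiffOn ℝ ∞ (inChart α x) (extChartAt 𝓘(ℝ, E) x).target

/-- The exterior derivative, computed at `x` in the preferred chart at `x`. -/
def extD (α : DiffForm E M k) : DiffForm E M (k + 1) := fun x =>
  (extDeriv (inChart α x) (extChartAt 𝓘(ℝ, E) x x)).compContinuousLinearMap
    (mfderiv 𝓘(ℝ, E) 𝓘(ℝ, E) (extChartAt 𝓘(ℝ, E) x) x)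

/-- The differential of a function, as a `1`-form. -/
def dFun (g : M → ℝ) : DiffForm E M 1 := fun x =>
  ContinuousAlternatingMap.ofSubsingleton ℝ (TangentSpace 𝓘(ℝ, E) x) ℝ (0 : Fin 1)
    (mfderiv 𝓘(ℝ, E) 𝓘(ℝ, ℝ) g x)

/-- The wedge product of a `1`-form and a `2`-form, evaluated on three tangent vectors. -/
def wedgeApply (lee : DiffForm E M 1) (Ω : DiffForm E M 2) (x : M)
    (u v w : TangentSpace 𝓘(ℝ, E) x) : ℝ :=
  lee x ![u] * Ω x ![v, w] + lee x ![v] * Ω x ![w, u] + lee x ![w] * Ω x ![u, v]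

/-- `Ω` is a locally conformal symplectic form with Lee form `lee`: `Ω` is a smooth
nondegenerate `2`-form and `lee` is a smooth closed `1`-form with `dΩ = lee ∧ Ω`. -/
structure IsLCS (Ω : DiffForm E M 2) (lee : DiffForm E M 1) : Prop where
  smooth_form : IsSmoothForm Ω
  nondegenerate : ∀ (x : M) (v : TangentSpace 𝓘(ℝ, E) x),
    (∀ w : TangentSpace 𝓘(ℝ, E) x, Ω x ![v, w] = 0) → v = 0
  smooth_lee : IsSmoothForm lee
  closed_lee : ∀ x : M, extD lee x = 0
  lee_eq : ∀ (x : M) (u v w : TangentSpace 𝓘(ℝ, E) x),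
    extD Ω x ![u, v, w] = wedgeApply lee Ω x u v w

/-- `τ` is a locally conformal symplectic form. -/
def IsLCSForm (τ : DiffForm E M 2) : Prop := ∃ α : DiffForm E M 1, IsLCS τ α

/-! ### Basic facts, needed for the foliated cohomology to be well defined -/

lemma inChart_add (α β : DiffForm E M k) (x : M) :
    inChart (α + β) x = inChart α x + inChart β x := rfl

lemma inChart_smul (c : ℝ) (α : DiffForm E M k) (x : M) :
    inChart (c • α) x = c • inChart α x := rfl

lemma inChart_zero (x : M) : inChart (0 : DiffForm E M k) x = 0 := rfl

lemma IsSmoothForm.zero : IsSmoothForm (0 : DiffForm E M k) := fun x => by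
  rw [inChart_zero]; exact contDiffOn_const

lemma IsSmoothForm.add {α β : DiffForm E M k} (hα : IsSmoothForm α) (hβ : IsSmoothForm β) :
    IsSmoothForm (α + β) := fun x => by
  rw [inChart_add]; exact (hα x).add (hβ x)

lemma IsSmoothForm.smul (c : ℝ) {α : DiffForm E M k} (hα : IsSmoothForm α) :
    IsSmoothForm (c • α) := fun x => by
  rw [inChart_smul]; exact (hα x).const_smul c

lemma IsSmoothForm.contDiffAt {α : DiffForm E M k} (hα : IsSmoothForm α) (x : M) {y : E}
    (hy : y ∈ (extChartAt 𝓘(ℝ, E) x).target) : ContDiffAt ℝ ∞ (inChart α x) y :=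
  (hα x).contDiffAt ((isOpen_extChartAt_target x).mem_nhds hy)

lemma IsSmoothForm.differentiableAt {α : DiffForm E M k} (hα : IsSmoothForm α) (x : M) :
    DifferentiableAt ℝ (inChart α x) (extChartAt 𝓘(ℝ, E) x x) :=
  (hα.contDiffAt x (mem_extChartAt_target x)).differentiableAt (by simp)

lemma extD_zero : extD (0 : DiffForm E M k) = 0 := by
  funext x
  have h : extDeriv (0 : E → E [⋀^Fin k]→L[ℝ] ℝ) (extChartAt 𝓘(ℝ, E) x x) = 0 := by
    have := extDeriv_smul (0 : ℝ) (0 : E → E [⋀^Fin k]→L[ℝ] ℝ) (x := extChartAt 𝓘(ℝ, E) x x)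
    simpa using this
  rw [extD, inChart_zero, h]
  rfl

lemma extD_add {α β : DiffForm E M k} (hα : IsSmoothForm α) (hβ : IsSmoothForm β) :
    extD (α + β) = extD α + extD β := by
  funext x
  rw [extD, inChart_add, extDeriv_add (hα.differentiableAt x) (hβ.differentiableAt x)]
  rfl

lemma extD_smul (c : ℝ) (α : DiffForm E M k) : extD (c • α) = c • extD α := by
  funext x
  rw [extD, inChart_smul, extDeriv_smul]
  rfl

/-- In charts, the pullback of a form on `M` is the pullback by the map written in charts. -/
lemma inChart_pullback [IsManifold 𝓘(ℝ, E) ∞ M] [IsManifold 𝓘(ℝ, E') ∞ Q]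
    {f : Q → M} (hf : ContMDiff 𝓘(ℝ, E') 𝓘(ℝ, E) ∞ f) (α : DiffForm E M k) (x : Q) (z : M)
    {y : E'} (hy : y ∈ (extChartAt 𝓘(ℝ, E') x).target)
    (hz : f ((extChartAt 𝓘(ℝ, E') x).symm y) ∈ (extChartAt 𝓘(ℝ, E) z).source) :
    ContDiffAt ℝ ∞ (extChartAt 𝓘(ℝ, E) z ∘ f ∘ (extChartAt 𝓘(ℝ, E') x).symm) y ∧
    inChart (pullback f α) x =ᶠ[𝓝 y] fun y' =>
      (inChart α z ((extChartAt 𝓘(ℝ, E) z ∘ f ∘ (extChartAt 𝓘(ℝ, E') x).symm) y')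
        ).compContinuousLinearMap
          (fderiv ℝ (extChartAt 𝓘(ℝ, E) z ∘ f ∘ (extChartAt 𝓘(ℝ, E') x).symm) y') := by
  set φ := extChartAt 𝓘(ℝ, E') x with hφ
  set ψ := extChartAt 𝓘(ℝ, E) z with hψ
  have hopen : IsOpen (φ.target ∩ (f ∘ φ.symm) ⁻¹' ψ.source) :=
    ((hf.continuous.comp_continuousOn (continuousOn_extChartAt_symm x)).isOpen_inter_preimage
      (isOpen_extChartAt_target x) (isOpen_extChartAt_source z))
  have hsymm : ∀ y' ∈ φ.target, ContMDiffAt 𝓘(ℝ, E') 𝓘(ℝ, E') ∞ φ.symm y' := fun y' hy' =>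
    (contMDiffOn_extChartAt_symm x).contMDiffAt ((isOpen_extChartAt_target x).mem_nhds hy')
  have hcomp : ∀ y' ∈ φ.target ∩ (f ∘ φ.symm) ⁻¹' ψ.source,
      ContMDiffAt 𝓘(ℝ, E') 𝓘(ℝ, E) ∞ (ψ ∘ f ∘ φ.symm) y' := fun y' hy' =>
    (contMDiffAt_extChartAt' (by simpa [hψ] using hy'.2)).comp y'
      (hf.contMDiffAt.comp y' (hsymm y' hy'.1))
  refine ⟨contMDiffAt_iff_contDiffAt.1 (hcomp y ⟨hy, hz⟩), ?_⟩
  filter_upwards [hopen.mem_nhds ⟨hy, hz⟩] with y' hy'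
  have hψt : ψ (f (φ.symm y')) ∈ ψ.target := ψ.map_source hy'.2
  have hψsymm : ContMDiffAt 𝓘(ℝ, E) 𝓘(ℝ, E) ∞ ψ.symm (ψ (f (φ.symm y'))) :=
    (contMDiffOn_extChartAt_symm z).contMDiffAt ((isOpen_extChartAt_target z).mem_nhds hψt)
  have hinv : ψ.symm (ψ (f (φ.symm y'))) = f (φ.symm y') := ψ.left_inv hy'.2
  have hne : (∞ : WithTop ℕ∞) ≠ 0 := by simp
  have h1 : mfderiv 𝓘(ℝ, E') 𝓘(ℝ, E) (f ∘ φ.symm) y' =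
      (mfderiv 𝓘(ℝ, E') 𝓘(ℝ, E) f (φ.symm y')).comp
        (mfderiv 𝓘(ℝ, E') 𝓘(ℝ, E') φ.symm y') :=
    mfderiv_comp y' (hf.contMDiffAt.mdifferentiableAt hne) ((hsymm y' hy'.1).mdifferentiableAt hne)
  have h2 : mfderiv 𝓘(ℝ, E') 𝓘(ℝ, E) (ψ.symm ∘ (ψ ∘ f ∘ φ.symm)) y' =
      (mfderiv 𝓘(ℝ, E) 𝓘(ℝ, E) ψ.symm (ψ (f (φ.symm y')))).comp
        (mfderiv 𝓘(ℝ, E') 𝓘(ℝ, E) (ψ ∘ f ∘ φ.symm) y') :=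
    mfderiv_comp y' (hψsymm.mdifferentiableAt hne) ((hcomp y' hy').mdifferentiableAt hne)
  have h3 : mfderiv 𝓘(ℝ, E') 𝓘(ℝ, E) (ψ.symm ∘ (ψ ∘ f ∘ φ.symm)) y' =
      mfderiv 𝓘(ℝ, E') 𝓘(ℝ, E) (f ∘ φ.symm) y' := by
    apply Filter.EventuallyEq.mfderiv_eq
    filter_upwards [hopen.mem_nhds hy'] with y'' hy''
    exact ψ.left_inv hy''.2
  rw [mfderiv_eq_fderiv] at h2
  have h4 := h2.symm.trans (h3.trans h1)
  ext v
  have h5 : ∀ w, mfderiv 𝓘(ℝ, E) 𝓘(ℝ, E) ψ.symm (ψ (f (φ.symm y')))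
      (fderiv ℝ (ψ ∘ f ∘ φ.symm) y' w) =
      mfderiv 𝓘(ℝ, E') 𝓘(ℝ, E) f (φ.symm y') (mfderiv 𝓘(ℝ, E') 𝓘(ℝ, E') φ.symm y' w) :=
    fun w => DFunLike.congr_fun h4 w
  have h6 : ∀ (m m' : M) (_ : m = m') (V : Fin k → E),
      (α m : E [⋀^Fin k]→L[ℝ] ℝ) V = (α m' : E [⋀^Fin k]→L[ℝ] ℝ) V := by
    rintro m _ rfl V; rfl
  have h7 : (fun i => mfderiv 𝓘(ℝ, E) 𝓘(ℝ, E) ψ.symm (ψ (f (φ.symm y')))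
      (fderiv ℝ (ψ ∘ f ∘ φ.symm) y' (v i)) : Fin k → E) = fun i =>
      mfderiv 𝓘(ℝ, E') 𝓘(ℝ, E) f (φ.symm y') (mfderiv 𝓘(ℝ, E') 𝓘(ℝ, E') φ.symm y' (v i)) :=
    funext fun i => h5 (v i)
  refine (h6 _ _ hinv.symm _).trans (Eq.symm ?_)
  exact congrArg (α (ψ.symm (ψ (f (φ.symm y')))) : E [⋀^Fin k]→L[ℝ] ℝ) h7

lemma contDiffAt_compContinuousLinearMap_one {F G G' : Type*} [NormedAddCommGroup F]
    [NormedSpace ℝ F] [NormedAddCommGroup G] [NormedSpace ℝ G] [NormedAddCommGroup G']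
    [NormedSpace ℝ G'] {a : F → G [⋀^Fin 1]→L[ℝ] ℝ} {b : F → G' →L[ℝ] G} {y : F}
    (ha : ContDiffAt ℝ ∞ a y) (hb : ContDiffAt ℝ ∞ b y) :
    ContDiffAt ℝ ∞ (fun y' => (a y').compContinuousLinearMap (b y')) y := by
  have h1 : ContDiffAt ℝ ∞ (fun y' =>
      ((ContinuousAlternatingMap.ofSubsingletonLIE (𝕜 := ℝ) (E := G) (F := ℝ) (0 : Fin 1)).symm (a y')).comp (b y')) y :=
    ((ContinuousAlternatingMap.ofSubsingletonLIE (𝕜 := ℝ) (E := G) (F := ℝ)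
      (0 : Fin 1)).symm.contDiff.contDiffAt.comp y ha).clm_comp hb
  have h2 := (ContinuousAlternatingMap.ofSubsingletonLIE (𝕜 := ℝ) (E := G') (F := ℝ)
      (0 : Fin 1)).contDiff.contDiffAt.comp y h1
  refine h2.congr_of_eventuallyEq (Filter.Eventually.of_forall fun y' => ?_)
  ext v
  have : b y' ∘ v = fun _ => b y' (v 0) := by
    funext i; rw [Subsingleton.elim i 0]; rfl
  change a y' (b y' ∘ v) = a y' (fun _ => b y' (v 0))
  rw [this]

/-- The pullback of a smooth `1`-form by a smooth map is smooth. -/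
lemma IsSmoothForm.pullback_one [IsManifold 𝓘(ℝ, E) ∞ M] [IsManifold 𝓘(ℝ, E') ∞ Q]
    {f : Q → M} (hf : ContMDiff 𝓘(ℝ, E') 𝓘(ℝ, E) ∞ f) {α : DiffForm E M 1}
    (hα : IsSmoothForm α) : IsSmoothForm (pullback f α : DiffForm E' Q 1) := by
  intro x y hy
  obtain ⟨h1, h2⟩ := inChart_pullback hf α x (f ((extChartAt 𝓘(ℝ, E') x).symm y)) hy
    (mem_extChartAt_source _)
  refine ContDiffAt.contDiffWithinAt (ContDiffAt.congr_of_eventuallyEq ?_ h2)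
  refine contDiffAt_compContinuousLinearMap_one ?_ (h1.fderiv_right (m := ∞) (by simp))
  exact (hα.contDiffAt _ (mem_extChartAt_target _)).comp y h1

/-- The pullback of a smooth closed form by a smooth map is closed. -/
lemma extD_pullback_eq_zero [IsManifold 𝓘(ℝ, E) ∞ M] [IsManifold 𝓘(ℝ, E') ∞ Q]
    {f : Q → M} (hf : ContMDiff 𝓘(ℝ, E') 𝓘(ℝ, E) ∞ f) {α : DiffForm E M k}
    (hα : IsSmoothForm α) (hd : ∀ x, extD α x = 0) (q : Q) :
    extD (pullback f α : DiffForm E' Q k) q = 0 := by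
  have hq : (extChartAt 𝓘(ℝ, E') q).symm (extChartAt 𝓘(ℝ, E') q q) = q :=
    extChartAt_to_inv q
  obtain ⟨h1, h2⟩ := inChart_pullback hf α q (f q) (mem_extChartAt_target q)
    (by rw [hq]; exact mem_extChartAt_source _)
  have hpt : (extChartAt 𝓘(ℝ, E) (f q) ∘ f ∘ (extChartAt 𝓘(ℝ, E') q).symm)
      (extChartAt 𝓘(ℝ, E') q q) = extChartAt 𝓘(ℝ, E) (f q) (f q) := by
    simp only [Function.comp_apply, hq]
  have h0 : extDeriv (inChart α (f q)) (extChartAt 𝓘(ℝ, E) (f q) (f q)) = 0 := by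
    have h := hd (f q)
    rw [extD] at h
    obtain ⟨e, he⟩ := isInvertible_mfderiv_extChartAt (I := 𝓘(ℝ, E)) (x := f q)
      (mem_extChartAt_source (f q))
    ext v
    have h' := DFunLike.congr_fun h (fun i => e.symm (v i))
    rw [← he] at h'
    have h'' : (extDeriv (inChart α (f q)) (extChartAt 𝓘(ℝ, E) (f q) (f q)))
      (fun i => e (e.symm (v i))) = 0 := h'
    have hv : (fun i => e (e.symm (v i))) = v := funext fun i => e.apply_symm_apply (v i)
    exact (congrArg _ hv.symm).trans h''
  rw [extD, h2.extDeriv_eq, extDeriv_pullback (r := ∞) _ h1 (by simpa using (WithTop.coe_le_coe.2 le_top : ((2 : ℕ∞) : WithTop ℕ∞) ≤ ∞)), hpt, h0]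
  · rfl
  · rw [hpt]; exact hα.differentiableAt (f q)

end Forms

section Foliation

variable {E' : Type*} [NormedAddCommGroup E'] [NormedSpace ℝ E']
  {Q : Type u} [TopologicalSpace Q] [ChartedSpace E' Q]

/-- `S` is (the underlying set of) a connected integral manifold of the distribution `D` on `Q`:
the image of an injectively immersed connected manifold whose tangent spaces are given by `D`. -/
def IsConnectedIntegralManifold (D : (q : Q) → Submodule ℝ (TangentSpace 𝓘(ℝ, E') q))
    (S : Set Q) : Prop :=
  ∃ (k : ℕ) (L : Type u) (_ : TopologicalSpace L) (_ : ChartedSpace (EuclideanSpace ℝ (Fin k)) L)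
    (j : L → Q),
    IsManifold (𝓡 k) ∞ L ∧ T2Space L ∧ SecondCountableTopology L ∧ ConnectedSpace L ∧
    Manifold.IsImmersion (𝓡 k) 𝓘(ℝ, E') ∞ j ∧ Function.Injective j ∧ Set.range j = S ∧
    ∀ p : L, (mfderiv (𝓡 k) 𝓘(ℝ, E') j p).range = D (j p)

/-- The leaves of the foliation tangent to `D` are the maximal connected integral manifolds
of `D`. -/
def IsLeaf (D : (q : Q) → Submodule ℝ (TangentSpace 𝓘(ℝ, E') q)) (S : Set Q) : Prop :=
  Maximal (IsConnectedIntegralManifold D) S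

/-- The map `π : Q → N` identifies `N` with the set of leaves of the foliation tangent to `D`:
the leaves are exactly the fibres of `π` (which are nonempty, as leaves are). -/
def IsLeafSpaceProjection {N : Type*} (D : (q : Q) → Submodule ℝ (TangentSpace 𝓘(ℝ, E') q))
    (π : Q → N) : Prop :=
  (∀ y : N, IsLeaf D (π ⁻¹' {y})) ∧ ∀ S : Set Q, IsLeaf D S → ∃ y : N, S = π ⁻¹' {y}

/-- The space `Ω¹(Q, F)` of smooth `1`-forms on `Q` that vanish on the vectors tangent to the
foliation `F` with tangent distribution `D`. -/
def vanishingForms (D : (q : Q) → Submodule ℝ (TangentSpace 𝓘(ℝ, E') q)) :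
    Submodule ℝ (DiffForm E' Q 1) where
  carrier := {α | IsSmoothForm α ∧ ∀ (q : Q), ∀ v ∈ D q, α q ![v] = 0}
  zero_mem' := ⟨.zero, fun _ _ _ => rfl⟩
  add_mem' := fun {α β} hα hβ => ⟨hα.1.add hβ.1, fun q v hv => by
    change α q ![v] + β q ![v] = 0
    rw [hα.2 q v hv, hβ.2 q v hv, add_zero]⟩
  smul_mem' := fun c α hα => ⟨hα.1.smul c, fun q v hv => by
    change c • α q ![v] = 0
    rw [hα.2 q v hv, smul_zero]⟩

/-- The smooth `1`-forms on `Q` that represent a cocycle of the complex `Ω^•(F)`, i.e. the smooth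
`1`-forms `α` such that `dα` vanishes on pairs of vectors tangent to `D`. -/
def foliatedCocycles (D : (q : Q) → Submodule ℝ (TangentSpace 𝓘(ℝ, E') q)) :
    Submodule ℝ (DiffForm E' Q 1) where
  carrier := {α | IsSmoothForm α ∧ ∀ (q : Q), ∀ u ∈ D q, ∀ v ∈ D q, extD α q ![u, v] = 0}
  zero_mem' := ⟨.zero, fun _ _ _ _ _ => by rw [extD_zero]; rfl⟩
  add_mem' := fun {α β} hα hβ => ⟨hα.1.add hβ.1, fun q u hu v hv => by
    rw [extD_add hα.1 hβ.1]
    change extD α q ![u, v] + extD β q ![u, v] = 0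
    rw [hα.2 q u hu v hv, hβ.2 q u hu v hv, add_zero]⟩
  smul_mem' := fun c α hα => ⟨hα.1.smul c, fun q u hu v hv => by
    rw [extD_smul]
    change c • extD α q ![u, v] = 0
    rw [hα.2 q u hu v hv, smul_zero]⟩

/-- The differentials of smooth functions. -/
def exactForms (E' : Type*) [NormedAddCommGroup E'] [NormedSpace ℝ E'] (Q : Type*)
    [TopologicalSpace Q] [ChartedSpace E' Q] : Submodule ℝ (DiffForm E' Q 1) where
  carrier := {α | ∃ g : Q → ℝ, ContMDiff 𝓘(ℝ, E') 𝓘(ℝ, ℝ) ∞ g ∧ α = dFun g}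
  zero_mem' := by
    refine ⟨fun _ => 0, contMDiff_const, ?_⟩
    funext q
    refine ContinuousAlternatingMap.ext fun v => ?_
    have h : mfderiv 𝓘(ℝ, E') 𝓘(ℝ, ℝ) (fun _ : Q => (0 : ℝ)) q = 0 := mfderiv_const
    change (0 : ℝ) = mfderiv 𝓘(ℝ, E') 𝓘(ℝ, ℝ) (fun _ : Q => (0 : ℝ)) q (v 0)
    rw [h]; rfl
  add_mem' := by
    rintro _ _ ⟨g, hg, rfl⟩ ⟨h, hh, rfl⟩
    refine ⟨g + h, hg.add hh, ?_⟩
    funext q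
    refine ContinuousAlternatingMap.ext fun v => ?_
    have hd := mfderiv_add (hg.contMDiffAt.mdifferentiableAt (x := q) (by simp))
      (hh.contMDiffAt.mdifferentiableAt (x := q) (by simp))
    exact (DFunLike.congr_fun hd (v 0)).symm
  smul_mem' := by
    rintro c _ ⟨g, hg, rfl⟩
    refine ⟨c • g, ((contDiff_const_smul c).contMDiff).comp hg, ?_⟩
    funext q
    refine ContinuousAlternatingMap.ext fun v => ?_
    have hd := const_smul_mfderiv (hg.contMDiffAt.mdifferentiableAt (x := q) (by simp)) c
    exact (DFunLike.congr_fun hd (v 0)).symm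

/-- The first de Rham cohomology `H¹(F)` tangent to the foliation `F` with tangent distribution
`D`. In the complex `Ω⁰(F) → Ω¹(F) → Ω²(F)` of forms on `Q` modulo forms vanishing on `F`, it is
the kernel modulo the image. It is written here as the quotient of the preimage of the kernel in
the smooth `1`-forms on `Q` by the preimage of the image, which consists of the sums of an exact
form and a form vanishing on `F`. -/
abbrev FoliatedH1 (D : (q : Q) → Submodule ℝ (TangentSpace 𝓘(ℝ, E') q)) : Type _ :=
  foliatedCocycles D ⧸ (exactForms E' Q ⊔ vanishingForms D).comap (foliatedCocycles D).subtype

/-- The class `[α] ∈ H¹(F)` of a smooth `1`-form `α` whose differential vanishes on `F`. -/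
def foliatedClass (D : (q : Q) → Submodule ℝ (TangentSpace 𝓘(ℝ, E') q)) (α : DiffForm E' Q 1)
    (hα : α ∈ foliatedCocycles D) : FoliatedH1 D :=
  Submodule.Quotient.mk ⟨α, hα⟩

end Foliation

section Submanifold

variable {E : Type*} [NormedAddCommGroup E] [NormedSpace ℝ E]
  {E' : Type*} [NormedAddCommGroup E'] [NormedSpace ℝ E']
  {M : Type*} [TopologicalSpace M] [ChartedSpace E M]
  {Q : Type*} [TopologicalSpace Q] [ChartedSpace E' Q]

/-- The `Ω`-orthogonal `V^Ω = {v | Ω(v, w) = 0 for all w ∈ V}` of a subspace `V` of `T_x M`. -/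
def omegaOrth (Ω : DiffForm E M 2) (x : M) (V : Submodule ℝ (TangentSpace 𝓘(ℝ, E) x)) :
    Submodule ℝ (TangentSpace 𝓘(ℝ, E) x) where
  carrier := {v | ∀ w ∈ V, Ω x ![v, w] = 0}
  zero_mem' := fun w _ => (Ω x).map_coord_zero 0 rfl
  add_mem' := fun {u v} hu hv w hw => by
    have h : Ω x ![u + v, w] = Ω x ![u, w] + Ω x ![v, w] :=
      (Ω x).toAlternatingMap.map_vecCons_add ![w] u v
    rw [h, hu w hw, hv w hw, add_zero]
  smul_mem' := fun c v hv w hw => by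
    have h : Ω x ![c • v, w] = c • Ω x ![v, w] :=
      (Ω x).toAlternatingMap.map_vecCons_smul ![w] c v
    rw [h, hv w hw, smul_zero]

/-- The characteristic distribution `(TQ)^Ω ∩ TQ` of an immersed submanifold `ι : Q → M`, as a
family of subspaces of the tangent spaces of `Q`; here `T_q Q` is identified with its image under
the differential of `ι`. -/
def charDist (E' : Type*) [NormedAddCommGroup E'] [NormedSpace ℝ E'] {Q : Type*}
    [TopologicalSpace Q] [ChartedSpace E' Q] (Ω : DiffForm E M 2) (ι : Q → M) (q : Q) :
    Submodule ℝ (TangentSpace 𝓘(ℝ, E') q) :=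
  (omegaOrth Ω (ι q) (mfderiv 𝓘(ℝ, E') 𝓘(ℝ, E) ι q).range).comap
    (mfderiv 𝓘(ℝ, E') 𝓘(ℝ, E) ι q).toLinearMap

/-- The restriction of the Lee form to a submanifold is closed, so it has a class in `H¹(F)`. -/
lemma IsLCS.pullback_lee_mem [IsManifold 𝓘(ℝ, E) ∞ M] [IsManifold 𝓘(ℝ, E') ∞ Q]
    {Ω : DiffForm E M 2} {lee : DiffForm E M 1} (h : IsLCS Ω lee) {ι : Q → M}
    (hι : Manifold.IsImmersion 𝓘(ℝ, E') 𝓘(ℝ, E) ∞ ι)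
    (D : (q : Q) → Submodule ℝ (TangentSpace 𝓘(ℝ, E') q)) :
    pullback ι lee ∈ foliatedCocycles D :=
  ⟨h.smooth_lee.pullback_one hι.contMDiff, fun q u _ v _ => by
    rw [extD_pullback_eq_zero hι.contMDiff h.smooth_lee h.closed_lee q]; rfl⟩

end Submanifold

end LCSReduction

end

open LCSReduction

/-!
Write `σ = ι^*Ω`, `λ = ι^*ω` and let `D = ker σ` be the characteristic distribution. The structure
equation pulls back to `dσ = λ ∧ σ`, and `dλ = 0`.

If `π^*τ = f σ` and `dτ = α ∧ τ`, then differentiating gives `(d log f + λ - π^*α) ∧ σ = 0`.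
Contracting with `v ∈ D`, which kills `σ` and `π^*α`, and using `σ ≠ 0`, one finds that
`λ - d(-log f)` vanishes on `D`, i.e. `[λ] = 0` (`pullback_lee_mem_of_reduction`).

Conversely, let `λ = dg + β` with `β` vanishing on `D`. Then `dβ = 0`, and `σ' = e^{-g} σ` satisfies
`dσ' = β ∧ σ'`. Hence `β`, `σ'` and their exterior derivatives are annihilated by `D`, and both forms
descend along `π` to forms `α` and `τ` with `dα = 0` and `dτ = α ∧ τ`; `τ` is nondegenerate because
the kernel of `σ'` is `D`, hence is killed by `dπ` (`exists_reduction_of_pullback_lee_mem`).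

Two facts carry the converse. The first is descent (`IsBasic.exists_pullback_eq`): in coordinates
that straighten `π`, a form `σ'` such that `σ'` and `dσ'` are annihilated by the vertical vectors does
not depend on the vertical coordinates, so it is locally constant along the fibres; the fibres are
leaves, hence connected, and local sections of `π` show that the form on the base is smooth. The
second is that vertical vectors lie in `D`, i.e. `ker dπ = D`
(`IsLeafSpaceProjection.mem_of_tangentMap_eq_zero`): a fibre is the image of a second countable
manifold of dimension `dim D`, so comparing Hausdorff dimensions `dim ker dπ ≤ dim D`, while
`D ⊆ ker dπ` since `π` is constant on leaves.
-/

noncomputable section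

namespace LCSReduction

/-! ### Families of alternating forms -/

section AlternatingForms

variable {V W G : Type*} [NormedAddCommGroup V] [NormedSpace ℝ V]
  [NormedAddCommGroup W] [NormedSpace ℝ W] [NormedAddCommGroup G] [NormedSpace ℝ G] {k : ℕ}

/-- A family of alternating forms on a finite-dimensional space is `C^n` as soon as all its values
are: evaluation on tuples of basis vectors is injective and has a continuous left inverse. -/
lemma contDiffAt_of_apply [FiniteDimensional ℝ V]
    {a : G → V [⋀^Fin k]→L[ℝ] ℝ} {y : G} {n : WithTop ℕ∞}
    (h : ∀ w : Fin k → V, ContDiffAt ℝ n (fun z => a z w) y) :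
    ContDiffAt ℝ n a y := by
  let b := Module.finBasis ℝ V
  let T : (V [⋀^Fin k]→L[ℝ] ℝ) →ₗ[ℝ] ((Fin k → Fin (Module.finrank ℝ V)) → ℝ) :=
    { toFun := fun f s => f (fun i => b (s i))
      map_add' := fun _ _ => rfl
      map_smul' := fun _ _ => rfl }
  have hT : Function.Injective T := by
    intro f g hfg
    refine ContinuousAlternatingMap.toAlternatingMap_injective
      (AlternatingMap.coe_multilinearMap_injective ?_)
    exact Module.Basis.ext_multilinear (fun _ => b) fun s => congrFun hfg s
  obtain ⟨S, hS⟩ := T.exists_leftInverse_of_injective (LinearMap.ker_eq_bot.2 hT)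
  have h' : ContDiffAt ℝ n (fun z => T (a z)) y := contDiffAt_pi.2 fun s => h _
  have := (LinearMap.toContinuousLinearMap S).contDiff.contDiffAt.comp y h'
  refine this.congr_of_eventuallyEq (Filter.Eventually.of_forall fun z => ?_)
  exact (DFunLike.congr_fun hS (a z)).symm

lemma contDiffAt_compContinuousLinearMap [FiniteDimensional ℝ V]
    {a : G → W [⋀^Fin k]→L[ℝ] ℝ} {b : G → V →L[ℝ] W} {y : G} {n : WithTop ℕ∞}
    (ha : ContDiffAt ℝ n a y) (hb : ContDiffAt ℝ n b y) :
    ContDiffAt ℝ n (fun z => (a z).compContinuousLinearMap (b z)) y := by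
  refine contDiffAt_of_apply fun w => ?_
  have h1 : ContDiff ℝ n (ContinuousMultilinearMap.compContinuousLinearMapContinuousMultilinear ℝ
      (fun _ : Fin k => V) (fun _ => W) ℝ) :=
    ContinuousMultilinearMap.contDiff (𝕜 := ℝ) (E := fun _ : Fin k => V →L[ℝ] W) _
  have h2 : ContDiffAt ℝ n (fun z => (a z).toContinuousMultilinearMap) y :=
    (ContinuousAlternatingMap.toContinuousMultilinearMapLI (𝕜 := ℝ) (E := W) (F := ℝ)
      (ι := Fin k)).contDiff.contDiffAt.comp y ha
  have h3 : ContDiffAt ℝ n (fun z => (fun _ : Fin k => b z)) y := contDiffAt_pi.2 fun _ => hb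
  have h4 := (h1.contDiffAt.comp y h3).clm_apply h2
  exact (ContinuousMultilinearMap.apply ℝ (fun _ : Fin k => V) ℝ w).contDiff.contDiffAt.comp y h4

lemma alternating_two_swap (f : V [⋀^Fin 2]→L[ℝ] ℝ) (u v : V) : f ![u, v] = - f ![v, u] := by
  have h := f.toAlternatingMap.map_swap ![v, u] (i := 0) (j := 1) (by decide)
  have h2 : (![v, u] ∘ Equiv.swap (0 : Fin 2) 1) = ![u, v] := by
    funext i; fin_cases i <;> simp
  rw [h2] at h
  exact h

/-- An alternating form that vanishes when some argument lies in `K` only depends on its arguments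
modulo `K`. -/
lemma alternating_congr_mod (f : V [⋀^Fin k]→L[ℝ] ℝ) (K : Submodule ℝ V)
    (hf : ∀ w : Fin k → V, ∀ i, w i ∈ K → f w = 0) {w w' : Fin k → V}
    (h : ∀ i, w i - w' i ∈ K) : f w = f w' := by
  classical
  -- Expand `f (w' + (w - w'))` multilinearly: every term but `f w'` has an argument in `K`.
  have key := f.toMultilinearMap.map_add_univ w' (fun i => w i - w' i)
  have hw : w' + (fun i => w i - w' i) = w := by ext i; simp
  rw [hw] at key
  refine key.trans ((Finset.sum_eq_single Finset.univ (fun s _ hs => ?_) (by simp)).trans ?_)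
  · obtain ⟨i, hi⟩ : ∃ i, i ∉ s := by
      by_contra! hc
      exact hs (Finset.eq_univ_of_forall hc)
    refine hf _ i ?_
    simp [Finset.piecewise, hi, h i]
  · simp

/-- If `a` and `da` vanish when their first argument is `t`, then `a` is infinitesimally constant
in the direction `t`. -/
lemma fderiv_eq_zero_of_extDeriv {a : V → V [⋀^Fin k]→L[ℝ] ℝ} {p t : V}
    (ha : DifferentiableAt ℝ a p)
    (h1 : ∀ᶠ y in 𝓝 p, ∀ (w : Fin k → V) (i : Fin k), w i = t → a y w = 0)
    (h2 : ∀ w : Fin (k + 1) → V, w 0 = t → extDeriv a p w = 0) :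
    fderiv ℝ a p t = 0 := by
  ext w
  have h := extDeriv_apply ha (Fin.cons t w : Fin (k + 1) → V)
  rw [h2 _ (Fin.cons_zero _ _), Fin.sum_univ_succ, Finset.sum_eq_zero] at h
  · have h3 := fderiv_continuousAlternatingMap_apply_const_apply ha w t
    simp [h3] at h
    simpa using h.symm
  · intro i _
    have h3 : (fun y => a y (i.succ.removeNth (Fin.cons t w : Fin (k + 1) → V))) =ᶠ[𝓝 p]
        fun _ => 0 := by
      filter_upwards [h1] with y hy
      cases k with
      | zero => exact i.elim0
      | succ m => exact hy _ 0 (by simp [Fin.removeNth])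
    rw [h3.fderiv_eq]
    simp

end AlternatingForms

/-! ### Pullbacks to normed spaces and naturality of the exterior derivative -/

section FormsAlongMaps

variable {E : Type*} [NormedAddCommGroup E] [NormedSpace ℝ E]
  {E' : Type*} [NormedAddCommGroup E'] [NormedSpace ℝ E']
  {V : Type*} [NormedAddCommGroup V] [NormedSpace ℝ V]
  {M : Type*} [TopologicalSpace M] [ChartedSpace E M]
  {Q : Type*} [TopologicalSpace Q] [ChartedSpace E' Q] {k : ℕ}

/-- The value of a form at `x`, as an alternating form on the model space `E`, of which `T_x M` is
by definition a copy. -/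
def formAt (α : DiffForm E M k) (x : M) : E [⋀^Fin k]→L[ℝ] ℝ := α x

/-- The differential of `f` at `x`, as a linear map between the model spaces. -/
def tangentMap (f : Q → M) (x : Q) : E' →L[ℝ] E := mfderiv 𝓘(ℝ, E') 𝓘(ℝ, E) f x

lemma tangentMap_comp {V : Type*} [NormedAddCommGroup V] [NormedSpace ℝ V]
    {P : Type*} [TopologicalSpace P] [ChartedSpace V P] {g : P → Q} {f : Q → M} {p : P}
    (hf : MDifferentiableAt 𝓘(ℝ, E') 𝓘(ℝ, E) f (g p))
    (hg : MDifferentiableAt 𝓘(ℝ, V) 𝓘(ℝ, E') g p) (v : V) :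
    (tangentMap (f ∘ g) p : V →L[ℝ] E) v =
      (tangentMap f (g p) : E' →L[ℝ] E) ((tangentMap g p : V →L[ℝ] E') v) :=
  DFunLike.congr_fun (mfderiv_comp p hf hg) v

lemma tangentMap_congr {f g : Q → M} {x : Q} (h : f =ᶠ[𝓝 x] g) :
    (tangentMap f x : E' →L[ℝ] E) = tangentMap g x :=
  h.mfderiv_eq

lemma tangentMap_id (x : M) : (tangentMap (id : M → M) x : E →L[ℝ] E) = .id ℝ E :=
  mfderiv_id

/-- The pullback of a form on `M` by a map `g : V → M` from a normed space, as a form on `V` in the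
sense of calculus in normed spaces; `inChart α x` is the case where `g` is the inverse of the chart
at `x`. -/
def formAlong (g : V → M) (α : DiffForm E M k) : V → V [⋀^Fin k]→L[ℝ] ℝ := fun p =>
  (α (g p)).compContinuousLinearMap (mfderiv 𝓘(ℝ, V) 𝓘(ℝ, E) g p)

lemma formAlong_apply (g : V → M) (α : DiffForm E M k) (p : V) (w : Fin k → V) :
    formAlong g α p w = formAt α (g p) (fun i => (tangentMap g p : V →L[ℝ] E) (w i)) := rfl

lemma inChart_eq_formAlong (α : DiffForm E M k) (x : M) :
    inChart α x = formAlong (extChartAt 𝓘(ℝ, E) x).symm α := rfl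

lemma infty_ne_zero : (∞ : WithTop ℕ∞) ≠ 0 := by simp

/-- The value of a form only depends on the base point up to equality of points; tangent spaces at
different points are all copies of the model space. -/
lemma form_congr (α : DiffForm E M k) {m m' : M} (h : m = m') {w w' : Fin k → E} (hw : w = w') :
    formAt α m w = formAt α m' w' := by
  subst h hw; rfl

/-- In the chart at `z`, the pullback of `α` by `g` is the pullback of the expression of `α` by the
expression of `g`. -/
lemma formAlong_eventuallyEq [IsManifold 𝓘(ℝ, E) ∞ M] {g : V → M} {U : Set V} (hU : IsOpen U)
    (hg : ContMDiffOn 𝓘(ℝ, V) 𝓘(ℝ, E) ∞ g U) (α : DiffForm E M k) {p : V} (hp : p ∈ U) (z : M)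
    (hz : g p ∈ (extChartAt 𝓘(ℝ, E) z).source) :
    ContDiffAt ℝ ∞ (extChartAt 𝓘(ℝ, E) z ∘ g) p ∧
    formAlong g α =ᶠ[𝓝 p] fun y =>
      (inChart α z ((extChartAt 𝓘(ℝ, E) z ∘ g) y)).compContinuousLinearMap
        (fderiv ℝ (extChartAt 𝓘(ℝ, E) z ∘ g) y) := by
  set ψ := extChartAt 𝓘(ℝ, E) z with hψ
  have hopen : IsOpen (U ∩ g ⁻¹' ψ.source) :=
    hg.continuousOn.isOpen_inter_preimage hU (isOpen_extChartAt_source z)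
  have hgat : ∀ y ∈ U, ContMDiffAt 𝓘(ℝ, V) 𝓘(ℝ, E) ∞ g y := fun y hy =>
    hg.contMDiffAt (hU.mem_nhds hy)
  have hcomp : ∀ y ∈ U ∩ g ⁻¹' ψ.source, ContMDiffAt 𝓘(ℝ, V) 𝓘(ℝ, E) ∞ (ψ ∘ g) y := fun y hy =>
    (contMDiffAt_extChartAt' (by simpa [hψ] using hy.2)).comp y (hgat y hy.1)
  refine ⟨contMDiffAt_iff_contDiffAt.1 (hcomp p ⟨hp, hz⟩), ?_⟩
  filter_upwards [hopen.mem_nhds ⟨hp, hz⟩] with y hy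
  have hψsymm : ContMDiffAt 𝓘(ℝ, E) 𝓘(ℝ, E) ∞ ψ.symm (ψ (g y)) :=
    (contMDiffOn_extChartAt_symm z).contMDiffAt
      ((isOpen_extChartAt_target z).mem_nhds (ψ.map_source hy.2))
  have h2 : mfderiv 𝓘(ℝ, V) 𝓘(ℝ, E) (ψ.symm ∘ (ψ ∘ g)) y =
      (mfderiv 𝓘(ℝ, E) 𝓘(ℝ, E) ψ.symm (ψ (g y))).comp (mfderiv 𝓘(ℝ, V) 𝓘(ℝ, E) (ψ ∘ g) y) :=
    mfderiv_comp y (hψsymm.mdifferentiableAt infty_ne_zero)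
      ((hcomp y hy).mdifferentiableAt infty_ne_zero)
  have h3 : mfderiv 𝓘(ℝ, V) 𝓘(ℝ, E) (ψ.symm ∘ (ψ ∘ g)) y = mfderiv 𝓘(ℝ, V) 𝓘(ℝ, E) g y := by
    apply Filter.EventuallyEq.mfderiv_eq
    filter_upwards [hopen.mem_nhds hy] with y' hy'
    exact ψ.left_inv hy'.2
  rw [mfderiv_eq_fderiv] at h2
  ext w
  exact form_congr α (ψ.left_inv hy.2).symm
    (funext fun i => DFunLike.congr_fun (h3.symm.trans h2) (w i))

lemma IsSmoothForm.formAlong [FiniteDimensional ℝ V] [IsManifold 𝓘(ℝ, E) ∞ M] {g : V → M}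
    {U : Set V} (hU : IsOpen U) (hg : ContMDiffOn 𝓘(ℝ, V) 𝓘(ℝ, E) ∞ g U) {α : DiffForm E M k}
    (hα : IsSmoothForm α) {p : V} (hp : p ∈ U) : ContDiffAt ℝ ∞ (formAlong g α) p := by
  obtain ⟨h1, h2⟩ := formAlong_eventuallyEq hU hg α hp (g p) (mem_extChartAt_source _)
  refine ContDiffAt.congr_of_eventuallyEq ?_ h2
  have h3 : ContDiffAt ℝ ∞ (inChart α (g p) ∘ (extChartAt 𝓘(ℝ, E) (g p) ∘ g)) p :=
    (hα.contDiffAt _ (mem_extChartAt_target _)).comp p h1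
  exact contDiffAt_compContinuousLinearMap h3 (h1.fderiv_right (m := ∞) (by simp))

/-- The exterior derivative commutes with the pullback to a normed space. -/
lemma extDeriv_formAlong [IsManifold 𝓘(ℝ, E) ∞ M] {g : V → M}
    {U : Set V} (hU : IsOpen U) (hg : ContMDiffOn 𝓘(ℝ, V) 𝓘(ℝ, E) ∞ g U) {α : DiffForm E M k}
    (hα : IsSmoothForm α) {p : V} (hp : p ∈ U) :
    extDeriv (formAlong g α) p = formAlong g (extD α) p := by
  obtain ⟨h1, h2⟩ := formAlong_eventuallyEq hU hg α hp (g p) (mem_extChartAt_source _)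
  have h4 : DifferentiableAt ℝ (inChart α (g p)) ((extChartAt 𝓘(ℝ, E) (g p) ∘ g) p) :=
    hα.differentiableAt (g p)
  rw [h2.extDeriv_eq, extDeriv_pullback (r := ∞) h4 h1
    (by simpa using (WithTop.coe_le_coe.2 le_top : ((2 : ℕ∞) : WithTop ℕ∞) ≤ ∞))]
  have h3 : mfderiv 𝓘(ℝ, V) 𝓘(ℝ, E) (extChartAt 𝓘(ℝ, E) (g p) ∘ g) p =
      (mfderiv 𝓘(ℝ, E) 𝓘(ℝ, E) (extChartAt 𝓘(ℝ, E) (g p)) (g p)).comp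
        (mfderiv 𝓘(ℝ, V) 𝓘(ℝ, E) g p) :=
    mfderiv_comp p (mdifferentiableAt_extChartAt (mem_chart_source _ _))
      ((hg.contMDiffAt (hU.mem_nhds hp)).mdifferentiableAt infty_ne_zero)
  rw [mfderiv_eq_fderiv] at h3
  ext w
  exact congrArg (extDeriv (inChart α (g p)) (extChartAt 𝓘(ℝ, E) (g p) (g p)))
    (funext fun i => DFunLike.congr_fun h3 (w i))

lemma formAlong_comp {g : V → Q} {f : Q → M} {p : V} (α : DiffForm E M k)
    (hf : MDifferentiableAt 𝓘(ℝ, E') 𝓘(ℝ, E) f (g p))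
    (hg : MDifferentiableAt 𝓘(ℝ, V) 𝓘(ℝ, E') g p) :
    formAlong (f ∘ g) α p = formAlong g (pullback f α : DiffForm E' Q k) p := by
  ext w
  have h := mfderiv_comp p hf hg
  exact form_congr α rfl (funext fun i => DFunLike.congr_fun h (w i))

lemma extChartAt_symm_mdifferentiableAt [IsManifold 𝓘(ℝ, E) ∞ M] (x : M) {y : E}
    (hy : y ∈ (extChartAt 𝓘(ℝ, E) x).target) :
    MDifferentiableAt 𝓘(ℝ, E) 𝓘(ℝ, E) (extChartAt 𝓘(ℝ, E) x).symm y :=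
  ((contMDiffOn_extChartAt_symm (n := ∞) x).contMDiffAt
    ((isOpen_extChartAt_target x).mem_nhds hy)).mdifferentiableAt infty_ne_zero

/-- The differentials of a chart and of its inverse compose to the identity. -/
lemma tangentMap_extChartAt_symm_comp [IsManifold 𝓘(ℝ, E) ∞ M] (x : M) (v : E) :
    (tangentMap (extChartAt 𝓘(ℝ, E) x).symm (extChartAt 𝓘(ℝ, E) x x) : E →L[ℝ] E)
      ((tangentMap (extChartAt 𝓘(ℝ, E) x) x : E →L[ℝ] E) v) = v := by
  rw [← tangentMap_comp (extChartAt_symm_mdifferentiableAt x (mem_extChartAt_target x))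
    (mdifferentiableAt_extChartAt (I := 𝓘(ℝ, E)) (mem_chart_source E x)),
    tangentMap_congr (g := id), tangentMap_id]
  · rfl
  · filter_upwards [extChartAt_source_mem_nhds (I := 𝓘(ℝ, E)) x] with y hy
    exact (extChartAt 𝓘(ℝ, E) x).left_inv hy

/-- A form is recovered at `x` from its expression in the chart at `x`. -/
lemma inChart_apply_tangentMap [IsManifold 𝓘(ℝ, E) ∞ M] (α : DiffForm E M k) (x : M)
    (w : Fin k → E) :
    inChart α x (extChartAt 𝓘(ℝ, E) x x)
      (fun i => (tangentMap (extChartAt 𝓘(ℝ, E) x) x : E →L[ℝ] E) (w i)) = formAt α x w :=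
  form_congr α (extChartAt_to_inv x)
    (funext fun i => tangentMap_extChartAt_symm_comp x (w i))

lemma extD_apply (α : DiffForm E M k) (x : M) (w : Fin (k + 1) → E) :
    formAt (extD α) x w = extDeriv (inChart α x) (extChartAt 𝓘(ℝ, E) x x)
      (fun i => (tangentMap (extChartAt 𝓘(ℝ, E) x) x : E →L[ℝ] E) (w i)) := rfl

lemma IsSmoothForm.pullback [FiniteDimensional ℝ E'] [IsManifold 𝓘(ℝ, E) ∞ M]
    [IsManifold 𝓘(ℝ, E') ∞ Q] {f : Q → M} (hf : ContMDiff 𝓘(ℝ, E') 𝓘(ℝ, E) ∞ f)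
    {α : DiffForm E M k} (hα : IsSmoothForm α) :
    IsSmoothForm (pullback f α : DiffForm E' Q k) := by
  intro x y hy
  refine ContDiffAt.contDiffWithinAt (ContDiffAt.congr_of_eventuallyEq
    (hα.formAlong (isOpen_extChartAt_target x)
      (hf.comp_contMDiffOn (contMDiffOn_extChartAt_symm x)) hy) ?_)
  filter_upwards [(isOpen_extChartAt_target x).mem_nhds hy] with y' hy'
  exact (formAlong_comp α (hf.contMDiffAt.mdifferentiableAt infty_ne_zero)
    (extChartAt_symm_mdifferentiableAt x hy')).symm

/-- The exterior derivative commutes with pullbacks. -/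
lemma extD_pullback_apply [IsManifold 𝓘(ℝ, E) ∞ M]
    [IsManifold 𝓘(ℝ, E') ∞ Q] {f : Q → M} (hf : ContMDiff 𝓘(ℝ, E') 𝓘(ℝ, E) ∞ f)
    {α : DiffForm E M k} (hα : IsSmoothForm α) (q : Q) (w : Fin (k + 1) → E') :
    formAt (extD (LCSReduction.pullback f α : DiffForm E' Q k)) q w =
      formAt (extD α) (f q) (fun i => (tangentMap f q : E' →L[ℝ] E) (w i)) := by
  have ht := mem_extChartAt_target (I := 𝓘(ℝ, E')) q
  have h1 : inChart (LCSReduction.pullback f α : DiffForm E' Q k) q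
      =ᶠ[𝓝 (extChartAt 𝓘(ℝ, E') q q)]
      LCSReduction.formAlong (f ∘ (extChartAt 𝓘(ℝ, E') q).symm) α := by
    filter_upwards [(isOpen_extChartAt_target q).mem_nhds ht] with y' hy'
    exact (formAlong_comp α (hf.contMDiffAt.mdifferentiableAt infty_ne_zero)
      (extChartAt_symm_mdifferentiableAt q hy')).symm
  rw [extD_apply, h1.extDeriv_eq, extDeriv_formAlong (isOpen_extChartAt_target q)
      (hf.comp_contMDiffOn (contMDiffOn_extChartAt_symm q)) hα ht,
    formAlong_comp (extD α) (hf.contMDiffAt.mdifferentiableAt infty_ne_zero)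
      (extChartAt_symm_mdifferentiableAt q ht), ← inChart_eq_formAlong, inChart_apply_tangentMap]
  rfl

end FormsAlongMaps

/-! ### Products with functions and differentials of functions -/

section LeibnizRule

variable {V : Type*} [NormedAddCommGroup V] [NormedSpace ℝ V]

lemma extDeriv_smul_two_apply {h : V → ℝ} {a : V → V [⋀^Fin 2]→L[ℝ] ℝ} {p : V}
    (hh : DifferentiableAt ℝ h p) (ha : DifferentiableAt ℝ a p) (u v w : V) :
    extDeriv (fun y => h y • a y) p ![u, v, w] =
      fderiv ℝ h p u * a p ![v, w] + fderiv ℝ h p v * a p ![w, u] +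
        fderiv ℝ h p w * a p ![u, v] + h p * extDeriv a p ![u, v, w] := by
  have hswap := alternating_two_swap (a p) u w
  have h0 : (0 : Fin 3).removeNth ![u, v, w] = ![v, w] := by
    funext i; fin_cases i <;> rfl
  have h1 : (1 : Fin 3).removeNth ![u, v, w] = ![u, w] := by
    funext i; fin_cases i <;> rfl
  have h2 : (2 : Fin 3).removeNth ![u, v, w] = ![u, v] := by
    funext i; fin_cases i <;> rfl
  rw [extDeriv, extDeriv, fderiv_fun_smul hh ha]
  rw [ContinuousAlternatingMap.alternatizeUncurryFin_apply,
    ContinuousAlternatingMap.alternatizeUncurryFin_apply, Fin.sum_univ_three, Fin.sum_univ_three,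
    h0, h1, h2]
  simp [hswap]
  ring

end LeibnizRule

section Functions

variable {E : Type*} [NormedAddCommGroup E] [NormedSpace ℝ E]
  {M : Type*} [TopologicalSpace M] [ChartedSpace E M]

/-- The product of a function and a form. -/
def funSMul {k : ℕ} (h : M → ℝ) (σ : DiffForm E M k) : DiffForm E M k := fun x => h x • σ x

variable [IsManifold 𝓘(ℝ, E) ∞ M]

lemma contDiffAt_comp_extChartAt_symm {g : M → ℝ} (hg : ContMDiff 𝓘(ℝ, E) 𝓘(ℝ, ℝ) ∞ g) (x : M)
    {y : E} (hy : y ∈ (extChartAt 𝓘(ℝ, E) x).target) :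
    ContDiffAt ℝ ∞ (g ∘ (extChartAt 𝓘(ℝ, E) x).symm) y :=
  contMDiffAt_iff_contDiffAt.1 (hg.contMDiffAt.comp y
    ((contMDiffOn_extChartAt_symm (n := ∞) x).contMDiffAt
      ((isOpen_extChartAt_target x).mem_nhds hy)))

lemma fderiv_comp_extChartAt_symm {g : M → ℝ} (hg : ContMDiff 𝓘(ℝ, E) 𝓘(ℝ, ℝ) ∞ g) (x : M)
    {y : E} (hy : y ∈ (extChartAt 𝓘(ℝ, E) x).target) (v : E) :
    fderiv ℝ (g ∘ (extChartAt 𝓘(ℝ, E) x).symm) y v =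
      (tangentMap g ((extChartAt 𝓘(ℝ, E) x).symm y) : E →L[ℝ] ℝ)
        ((tangentMap (extChartAt 𝓘(ℝ, E) x).symm y : E →L[ℝ] E) v) := by
  have h := mfderiv_comp y (hg.contMDiffAt.mdifferentiableAt infty_ne_zero)
    (extChartAt_symm_mdifferentiableAt x hy)
  rw [mfderiv_eq_fderiv] at h
  exact DFunLike.congr_fun h v

/-- In a chart, `dg` is the exterior derivative of `g` regarded as a `0`-form. -/
lemma inChart_dFun_eventuallyEq {g : M → ℝ} (hg : ContMDiff 𝓘(ℝ, E) 𝓘(ℝ, ℝ) ∞ g) (x : M)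
    {y : E} (hy : y ∈ (extChartAt 𝓘(ℝ, E) x).target) :
    inChart (dFun g : DiffForm E M 1) x =ᶠ[𝓝 y] extDeriv (fun z =>
      ContinuousAlternatingMap.constOfIsEmpty ℝ E (Fin 0)
        ((g ∘ (extChartAt 𝓘(ℝ, E) x).symm) z)) := by
  filter_upwards [(isOpen_extChartAt_target x).mem_nhds hy] with z hz
  rw [extDeriv_constOfIsEmpty]
  ext v
  exact (fderiv_comp_extChartAt_symm hg x hz (v 0)).symm

lemma contDiffAt_constOfIsEmpty {g : M → ℝ} (hg : ContMDiff 𝓘(ℝ, E) 𝓘(ℝ, ℝ) ∞ g) (x : M)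
    {y : E} (hy : y ∈ (extChartAt 𝓘(ℝ, E) x).target) :
    ContDiffAt ℝ ∞ (fun z => ContinuousAlternatingMap.constOfIsEmpty ℝ E (Fin 0)
        ((g ∘ (extChartAt 𝓘(ℝ, E) x).symm) z)) y :=
  (ContinuousAlternatingMap.constOfIsEmptyLIE ℝ E ℝ (Fin 0)).contDiff.contDiffAt.comp y
    (contDiffAt_comp_extChartAt_symm hg x hy)

lemma isSmoothForm_dFun {g : M → ℝ} (hg : ContMDiff 𝓘(ℝ, E) 𝓘(ℝ, ℝ) ∞ g) :
    IsSmoothForm (dFun g : DiffForm E M 1) := by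
  intro x y hy
  refine ContDiffAt.contDiffWithinAt (ContDiffAt.congr_of_eventuallyEq ?_
    (inChart_dFun_eventuallyEq hg x hy))
  exact (ContinuousAlternatingMap.alternatizeUncurryFinCLM ℝ E ℝ).contDiff.contDiffAt.comp y
    ((contDiffAt_constOfIsEmpty hg x hy).fderiv_right (m := ∞) (by simp))

lemma extD_dFun {g : M → ℝ} (hg : ContMDiff 𝓘(ℝ, E) 𝓘(ℝ, ℝ) ∞ g) :
    extD (dFun g : DiffForm E M 1) = 0 := by
  funext x
  have ht := mem_extChartAt_target (I := 𝓘(ℝ, E)) x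
  rw [extD, (inChart_dFun_eventuallyEq hg x ht).extDeriv_eq,
    extDeriv_extDeriv_apply (contDiffAt_constOfIsEmpty hg x ht)
      (by simpa using (WithTop.coe_le_coe.2 le_top : ((2 : ℕ∞) : WithTop ℕ∞) ≤ ∞))]
  rfl

lemma isSmoothForm_funSMul {k : ℕ} {h : M → ℝ} (hh : ContMDiff 𝓘(ℝ, E) 𝓘(ℝ, ℝ) ∞ h)
    {σ : DiffForm E M k} (hσ : IsSmoothForm σ) :
    IsSmoothForm (funSMul h σ) := fun x _ hy =>
  ((contDiffAt_comp_extChartAt_symm hh x hy).smul (hσ.contDiffAt x hy)).contDiffWithinAt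

/-- The Leibniz rule `d(hσ) = dh ∧ σ + h dσ` for a function `h` and a `2`-form `σ`. -/
lemma extD_funSMul_apply {h : M → ℝ} (hh : ContMDiff 𝓘(ℝ, E) 𝓘(ℝ, ℝ) ∞ h)
    {σ : DiffForm E M 2} (hσ : IsSmoothForm σ) (x : M) (u v w : E) :
    formAt (extD (funSMul h σ)) x ![u, v, w] =
      (tangentMap h x : E →L[ℝ] ℝ) u * formAt σ x ![v, w] +
      (tangentMap h x : E →L[ℝ] ℝ) v * formAt σ x ![w, u] +
      (tangentMap h x : E →L[ℝ] ℝ) w * formAt σ x ![u, v] +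
      h x * formAt (extD σ) x ![u, v, w] := by
  have ht := mem_extChartAt_target (I := 𝓘(ℝ, E)) x
  set T : E →L[ℝ] E := tangentMap (extChartAt 𝓘(ℝ, E) x) x with hT
  have h3 : (fun i => T (![u, v, w] i)) = ![T u, T v, T w] := by
    funext i; fin_cases i <;> rfl
  have hd : ∀ v, fderiv ℝ (h ∘ (extChartAt 𝓘(ℝ, E) x).symm) (extChartAt 𝓘(ℝ, E) x x) (T v) =
      (tangentMap h x : E →L[ℝ] ℝ) v := by
    intro v
    rw [fderiv_comp_extChartAt_symm hh x ht, hT, tangentMap_extChartAt_symm_comp,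
      extChartAt_to_inv]
  have hs : ∀ v w, inChart σ x (extChartAt 𝓘(ℝ, E) x x) ![T v, T w] = formAt σ x ![v, w] := by
    intro v w
    rw [← inChart_apply_tangentMap σ x ![v, w]]
    congr 1
    funext i; fin_cases i <;> rfl
  have hc : inChart (funSMul h σ) x =
      fun y => (h ∘ (extChartAt 𝓘(ℝ, E) x).symm) y • inChart σ x y := rfl
  rw [extD_apply, extD_apply, ← hT, h3, hc, extDeriv_smul_two_apply
    ((contDiffAt_comp_extChartAt_symm hh x ht).differentiableAt infty_ne_zero)
    (hσ.differentiableAt x), hd, hd, hd, hs, hs, hs, Function.comp_apply, extChartAt_to_inv]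

end Functions

/-! ### Straightening a submersion -/

section Submersions

variable {E : Type*} [NormedAddCommGroup E] [NormedSpace ℝ E]
  {E' : Type*} [NormedAddCommGroup E'] [NormedSpace ℝ E']
  {F : Type*} [NormedAddCommGroup F] [NormedSpace ℝ F]
  {N : Type*} [TopologicalSpace N] [ChartedSpace E N]
  {Q : Type*} [TopologicalSpace Q] [ChartedSpace E' Q] {π : Q → N}

/-- Smooth coordinates `e` on an open subset of `Q` and `c` on an open subset of `N` in which the
map `π` becomes the projection `E × F → E`. -/
structure Straightening (E E' F : Type*) [NormedAddCommGroup E] [NormedSpace ℝ E]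
    [NormedAddCommGroup E'] [NormedSpace ℝ E'] [NormedAddCommGroup F] [NormedSpace ℝ F]
    {N : Type*} [TopologicalSpace N] [ChartedSpace E N]
    {Q : Type*} [TopologicalSpace Q] [ChartedSpace E' Q] (π : Q → N) where
  /-- The coordinates on `Q`. -/
  e : OpenPartialHomeomorph Q (E × F)
  /-- The coordinates on `N`. -/
  c : OpenPartialHomeomorph N E
  contMDiffOn_e : ContMDiffOn 𝓘(ℝ, E') 𝓘(ℝ, E × F) ∞ e e.source
  contMDiffOn_e_symm : ContMDiffOn 𝓘(ℝ, E × F) 𝓘(ℝ, E') ∞ e.symm e.target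
  contMDiffOn_c : ContMDiffOn 𝓘(ℝ, E) 𝓘(ℝ, E) ∞ c c.source
  contMDiffOn_c_symm : ContMDiffOn 𝓘(ℝ, E) 𝓘(ℝ, E) ∞ c.symm c.target
  mapsTo : ∀ x ∈ e.source, π x ∈ c.source
  c_apply : ∀ x ∈ e.source, c (π x) = (e x).1

lemma exists_straightening {q : Q}
    (h : Manifold.IsSubmersionAtOfComplement F 𝓘(ℝ, E') 𝓘(ℝ, E) ∞ π q) :
    ∃ S : Straightening E E' F π, q ∈ S.e.source := by
  refine ⟨⟨h.domChart.transHomeomorph h.equiv.toHomeomorph, h.codChart, ?_, ?_,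
    contMDiffOn_of_mem_maximalAtlas h.codChart_mem_maximalAtlas,
    contMDiffOn_symm_of_mem_maximalAtlas h.codChart_mem_maximalAtlas, ?_, ?_⟩, ?_⟩
  · exact h.equiv.contDiff.contMDiff.comp_contMDiffOn
      (contMDiffOn_of_mem_maximalAtlas h.domChart_mem_maximalAtlas)
  · exact (contMDiffOn_symm_of_mem_maximalAtlas h.domChart_mem_maximalAtlas).comp
      h.equiv.symm.contDiff.contMDiff.contMDiffOn (fun p hp => by simpa using hp)
  · intro x hx
    exact h.mapsto_domChart_source_codChart_source (by simpa using hx)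
  · intro x hx
    have hx' : x ∈ h.domChart.source := by simpa using hx
    have h0 : h.domChart x ∈ (h.domChart.extend 𝓘(ℝ, E')).target := by
      simpa using h.domChart.map_source hx'
    have h1 := h.writtenInCharts h0
    simpa [h.domChart.left_inv hx'] using h1
  · simpa using h.mem_domChart_source

namespace Straightening

variable (S : Straightening E E' F π)
include S

lemma contMDiffAt_e {x : Q} (hx : x ∈ S.e.source) :
    ContMDiffAt 𝓘(ℝ, E') 𝓘(ℝ, E × F) ∞ S.e x :=
  S.contMDiffOn_e.contMDiffAt (S.e.open_source.mem_nhds hx)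

lemma contMDiffAt_e_symm {p : E × F} (hp : p ∈ S.e.target) :
    ContMDiffAt 𝓘(ℝ, E × F) 𝓘(ℝ, E') ∞ S.e.symm p :=
  S.contMDiffOn_e_symm.contMDiffAt (S.e.open_target.mem_nhds hp)

lemma fst_mem_target {p : E × F} (hp : p ∈ S.e.target) : p.1 ∈ S.c.target := by
  have h1 := S.e.map_target hp
  have h2 := S.c_apply _ h1
  rw [S.e.right_inv hp] at h2
  rw [← h2]
  exact S.c.map_source (S.mapsTo _ h1)

lemma apply_e_symm {p : E × F} (hp : p ∈ S.e.target) : π (S.e.symm p) = S.c.symm p.1 := by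
  have h1 := S.e.map_target hp
  have h2 := S.c_apply _ h1
  rw [S.e.right_inv hp] at h2
  rw [← h2, S.c.left_inv (S.mapsTo _ h1)]

lemma contMDiffAt {x : Q} (hx : x ∈ S.e.source) : ContMDiffAt 𝓘(ℝ, E') 𝓘(ℝ, E) ∞ π x := by
  have h1 : ContMDiffAt 𝓘(ℝ, E') 𝓘(ℝ, E) ∞ (S.c.symm ∘ Prod.fst ∘ S.e) x := by
    refine ContMDiffAt.comp x (S.contMDiffOn_c_symm.contMDiffAt (S.c.open_target.mem_nhds
      (S.fst_mem_target (S.e.map_source hx)))) ?_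
    exact contDiff_fst.contMDiff.contMDiffAt.comp x (S.contMDiffAt_e hx)
  refine h1.congr_of_eventuallyEq ?_
  filter_upwards [S.e.open_source.mem_nhds hx] with x' hx'
  rw [Function.comp_apply, Function.comp_apply, ← S.c_apply x' hx', S.c.left_inv (S.mapsTo _ hx')]

/-- A submersion has a smooth local section through each point. -/
lemma exists_section {x : Q} (hx : x ∈ S.e.source) :
    ∃ (s : N → Q) (U : Set N), IsOpen U ∧ π x ∈ U ∧ s (π x) = x ∧
      ContMDiffOn 𝓘(ℝ, E) 𝓘(ℝ, E') ∞ s U ∧ ∀ y ∈ U, π (s y) = y := by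
  have hslice : ContMDiffOn 𝓘(ℝ, E) 𝓘(ℝ, E × F) ∞ (fun y => (S.c y, (S.e x).2)) S.c.source := by
    have : ContDiff ℝ ∞ (fun z : E => (z, (S.e x).2)) := by fun_prop
    exact this.contMDiff.comp_contMDiffOn S.contMDiffOn_c
  have hxe : (S.c (π x), (S.e x).2) = S.e x := Prod.ext (S.c_apply x hx) rfl
  refine ⟨fun y => S.e.symm (S.c y, (S.e x).2),
    S.c.source ∩ (fun y => (S.c y, (S.e x).2)) ⁻¹' S.e.target,
    hslice.continuousOn.isOpen_inter_preimage S.c.open_source S.e.open_target,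
    ⟨S.mapsTo x hx, ?_⟩, ?_, ?_, ?_⟩
  · rw [Set.mem_preimage, hxe]
    exact S.e.map_source hx
  · change S.e.symm (S.c (π x), (S.e x).2) = x
    rw [hxe, S.e.left_inv hx]
  · exact S.contMDiffOn_e_symm.comp (hslice.mono Set.inter_subset_left) fun y hy => hy.2
  · intro y hy
    rw [S.apply_e_symm hy.2, S.c.left_inv hy.1]

omit S in
lemma tangentMap_section {s : N → Q} {U : Set N} (hU : IsOpen U)
    (hs : ContMDiffOn 𝓘(ℝ, E) 𝓘(ℝ, E') ∞ s U) (hsec : ∀ y ∈ U, π (s y) = y) {y : N} (hy : y ∈ U)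
    (hπ : MDifferentiableAt 𝓘(ℝ, E') 𝓘(ℝ, E) π (s y)) (v : E) :
    (tangentMap π (s y) : E' →L[ℝ] E) ((tangentMap s y : E →L[ℝ] E') v) = v := by
  rw [← tangentMap_comp hπ ((hs.contMDiffAt (hU.mem_nhds hy)).mdifferentiableAt infty_ne_zero),
    tangentMap_congr (g := id), tangentMap_id]
  · rfl
  · filter_upwards [hU.mem_nhds hy] with y' hy'
    exact hsec y' hy'

lemma exists_rightInverse {x : Q} (hx : x ∈ S.e.source) :
    ∃ R : E →L[ℝ] E', ∀ v, (tangentMap π x : E' →L[ℝ] E) (R v) = v := by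
  obtain ⟨s, U, hU, hxU, hsx, hs, hsec⟩ := S.exists_section hx
  refine ⟨tangentMap s (π x), fun v => ?_⟩
  have := tangentMap_section hU hs hsec hxU
    (by rw [hsx]; exact (S.contMDiffAt hx).mdifferentiableAt infty_ne_zero) v
  rwa [hsx] at this

/-- In straightening coordinates the differential of `π` is the projection `E × F → E`, followed by
the differential of the coordinates of `N`. -/
lemma tangentMap_tangentMap_e_symm {p : E × F} (hp : p ∈ S.e.target) (u : E × F) :
    (tangentMap π (S.e.symm p) : E' →L[ℝ] E) ((tangentMap S.e.symm p : E × F →L[ℝ] E') u) =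
      (tangentMap S.c.symm p.1 : E →L[ℝ] E) u.1 := by
  have h1 : MDifferentiableAt 𝓘(ℝ, E × F) 𝓘(ℝ, E) (Prod.fst : E × F → E) p :=
    differentiableAt_fst.mdifferentiableAt
  have h2 : (tangentMap (Prod.fst : E × F → E) p : E × F →L[ℝ] E) = ContinuousLinearMap.fst ℝ E F :=
    mfderiv_eq_fderiv.trans fderiv_fst
  rw [← tangentMap_comp ((S.contMDiffAt (S.e.map_target hp)).mdifferentiableAt infty_ne_zero)
    ((S.contMDiffAt_e_symm hp).mdifferentiableAt infty_ne_zero),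
    tangentMap_congr (g := S.c.symm ∘ Prod.fst), tangentMap_comp _ h1, h2]
  · rfl
  · exact (S.contMDiffOn_c_symm.contMDiffAt (S.c.open_target.mem_nhds
      (S.fst_mem_target hp))).mdifferentiableAt infty_ne_zero
  · filter_upwards [S.e.open_target.mem_nhds hp] with p' hp'
    exact S.apply_e_symm hp'

lemma tangentMap_e_symm_tangentMap_e {x : Q} (hx : x ∈ S.e.source)
    (v : E') :
    (tangentMap S.e.symm (S.e x) : E × F →L[ℝ] E') ((tangentMap S.e x : E' →L[ℝ] E × F) v) = v := by
  rw [← tangentMap_comp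
    ((S.contMDiffAt_e_symm (S.e.map_source hx)).mdifferentiableAt infty_ne_zero)
    ((S.contMDiffAt_e hx).mdifferentiableAt infty_ne_zero),
    tangentMap_congr (g := id), tangentMap_id]
  · rfl
  · filter_upwards [S.e.open_source.mem_nhds hx] with x' hx'
    exact S.e.left_inv hx'

end Straightening
end Submersions

/-! ### Descent of basic forms -/

section BasicForms

variable {E : Type*} [NormedAddCommGroup E] [NormedSpace ℝ E]
  {E' : Type*} [NormedAddCommGroup E'] [NormedSpace ℝ E']
  {F : Type*} [NormedAddCommGroup F] [NormedSpace ℝ F]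
  {N : Type*} [TopologicalSpace N] [ChartedSpace E N]
  {Q : Type*} [TopologicalSpace Q] [ChartedSpace E' Q] {π : Q → N} {k : ℕ}

/-- A smooth form `σ` on `Q` is basic for `π : Q → N` if both `σ` and `dσ` are annihilated by the
vectors tangent to the fibres of `π`. -/
structure IsBasic (E : Type*) [NormedAddCommGroup E] [NormedSpace ℝ E]
    {E' : Type*} [NormedAddCommGroup E'] [NormedSpace ℝ E']
    {N : Type*} [TopologicalSpace N] [ChartedSpace E N]
    {Q : Type*} [TopologicalSpace Q] [ChartedSpace E' Q] {k : ℕ}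
    (π : Q → N) (σ : DiffForm E' Q k) : Prop where
  smooth : IsSmoothForm σ
  horizontal : ∀ (x : Q) (w : Fin k → E') (i : Fin k),
    (tangentMap π x : E' →L[ℝ] E) (w i) = 0 → formAt σ x w = 0
  horizontal_extD : ∀ (x : Q) (w : Fin (k + 1) → E'),
    (tangentMap π x : E' →L[ℝ] E) (w 0) = 0 → formAt (extD σ) x w = 0

/-- `σ` at `x` is the pullback of the alternating form `τ` by the differential of `π`. -/
def DescendsTo (π : Q → N) (σ : DiffForm E' Q k) (x : Q) (τ : E [⋀^Fin k]→L[ℝ] ℝ) : Prop :=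
  ∀ w : Fin k → E', formAt σ x w = τ (fun i => (tangentMap π x : E' →L[ℝ] E) (w i))

variable [FiniteDimensional ℝ E] [FiniteDimensional ℝ F] [IsManifold 𝓘(ℝ, E') ∞ Q]
  {σ : DiffForm E' Q k}

/-- In straightening coordinates, a basic form has vanishing derivative along the fibres. -/
lemma IsBasic.fderiv_formAlong_eq_zero (hσ : IsBasic E π σ) (S : Straightening E E' F π)
    {p : E × F} (hp : p ∈ S.e.target) (t : F) :
    fderiv ℝ (formAlong S.e.symm σ) p (0, t) = 0 := by
  have hvert : ∀ p' ∈ S.e.target, (tangentMap π (S.e.symm p') : E' →L[ℝ] E)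
      ((tangentMap S.e.symm p' : E × F →L[ℝ] E') (0, t)) = 0 := fun p' hp' => by
    rw [S.tangentMap_tangentMap_e_symm hp', map_zero]
  refine fderiv_eq_zero_of_extDeriv ((hσ.smooth.formAlong S.e.open_target S.contMDiffOn_e_symm
    hp).differentiableAt infty_ne_zero) ?_ ?_
  · filter_upwards [S.e.open_target.mem_nhds hp] with p' hp' w i hi
    rw [formAlong_apply]
    refine hσ.horizontal _ _ i ?_
    rw [hi, hvert p' hp']
  · intro w hw
    rw [extDeriv_formAlong S.e.open_target S.contMDiffOn_e_symm hσ.smooth hp, formAlong_apply]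
    refine hσ.horizontal_extD _ _ ?_
    rw [hw, hvert p hp]

/-- In straightening coordinates, a basic form is locally constant along the fibres. -/
lemma IsBasic.eventually_formAlong_eq (hσ : IsBasic E π σ) (S : Straightening E E' F π)
    {x : Q} (hx : x ∈ S.e.source) :
    ∀ᶠ x' in 𝓝 x, π x' = π x →
      formAlong S.e.symm σ (S.e x') = formAlong S.e.symm σ (S.e x) := by
  obtain ⟨r, hr, hball⟩ := Metric.isOpen_iff.1 S.e.open_target _ (S.e.map_source hx)
  have hnear : ∀ᶠ x' in 𝓝 x, S.e x' ∈ Metric.ball (S.e x) r :=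
    (S.e.continuousAt hx).eventually (Metric.ball_mem_nhds _ hr)
  filter_upwards [hnear, S.e.open_source.mem_nhds hx] with x' hx'ball hx' hπ
  have hfst : (S.e x').1 = (S.e x).1 := by rw [← S.c_apply x' hx', hπ, S.c_apply x hx]
  have hmem : ∀ t ∈ Metric.ball (S.e x).2 r, ((S.e x).1, t) ∈ S.e.target := fun t ht =>
    hball (by
      rw [Metric.mem_ball, Prod.dist_eq]
      simpa [hr] using ht)
  have hslice : ∀ t ∈ Metric.ball (S.e x).2 r,
      HasFDerivAt (fun t => formAlong S.e.symm σ ((S.e x).1, t)) 0 t := fun t ht => by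
    have h1 := ((hσ.smooth.formAlong S.e.open_target S.contMDiffOn_e_symm
      (hmem t ht)).differentiableAt infty_ne_zero).hasFDerivAt.comp t
        (hasFDerivAt_prodMk_right (S.e x).1 t)
    refine h1.congr_fderiv ?_
    ext1 v
    exact hσ.fderiv_formAlong_eq_zero S (hmem t ht) v
  have hconst := Metric.isOpen_ball.is_const_of_fderiv_eq_zero (𝕜 := ℝ)
    (convex_ball (S.e x).2 r).isPreconnected
    (fun t ht => (hslice t ht).differentiableAt.differentiableWithinAt)
    (fun t ht => (hslice t ht).fderiv) (x := (S.e x').2) (y := (S.e x).2)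
    (by
      rw [Metric.mem_ball, Prod.dist_eq] at hx'ball
      exact (le_max_right _ _).trans_lt hx'ball) (Metric.mem_ball_self hr)
  have h1 : S.e x' = ((S.e x).1, (S.e x').2) := Prod.ext hfst rfl
  rw [h1]
  exact hconst

omit [FiniteDimensional ℝ E] [FiniteDimensional ℝ F] [IsManifold 𝓘(ℝ, E') ∞ Q] in
/-- In straightening coordinates the condition that `σ` at `x` be the pullback of `τ` involves `x`
only through `π x` and the value of the coordinate expression of `σ`. -/
lemma descendsTo_iff_formAlong (S : Straightening E E' F π) {x : Q} (hx : x ∈ S.e.source)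
    (τ : E [⋀^Fin k]→L[ℝ] ℝ) :
    DescendsTo π σ x τ ↔ ∀ u : Fin k → E × F, formAlong S.e.symm σ (S.e x) u =
      τ (fun i => (tangentMap S.c.symm (S.c (π x)) : E →L[ℝ] E) (u i).1) := by
  have hcompat := S.tangentMap_tangentMap_e_symm (S.e.map_source hx)
  rw [S.e.left_inv hx, ← S.c_apply x hx] at hcompat
  constructor
  · intro h u
    rw [formAlong_apply, S.e.left_inv hx, h]
    simp only [hcompat]
  · intro h w
    have h1 := h (fun i => (tangentMap S.e x : E' →L[ℝ] E × F) (w i))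
    simp only [← hcompat, formAlong_apply, S.tangentMap_e_symm_tangentMap_e hx] at h1
    rwa [S.e.left_inv hx] at h1

lemma IsBasic.eventually_descendsTo_iff (hσ : IsBasic E π σ) (S : Straightening E E' F π)
    {x : Q} (hx : x ∈ S.e.source) :
    ∀ᶠ x' in 𝓝 x, π x' = π x → ∀ τ : E [⋀^Fin k]→L[ℝ] ℝ,
      DescendsTo π σ x τ ↔ DescendsTo π σ x' τ := by
  filter_upwards [hσ.eventually_formAlong_eq S hx, S.e.open_source.mem_nhds hx]
    with x' h hx' hπ τ
  rw [descendsTo_iff_formAlong S hx, descendsTo_iff_formAlong S hx', h hπ, hπ]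

omit [FiniteDimensional ℝ E] [FiniteDimensional ℝ F] [IsManifold 𝓘(ℝ, E') ∞ Q] in
/-- Precompose `σ` at `x` with a right inverse of `dπ`; horizontality makes the choice harmless. -/
lemma IsBasic.exists_descendsTo (hσ : IsBasic E π σ) (S : Straightening E E' F π)
    {x : Q} (hx : x ∈ S.e.source) : ∃ τ, DescendsTo (E := E) π σ x τ := by
  obtain ⟨R, hR⟩ := S.exists_rightInverse hx
  refine ⟨(formAt σ x).compContinuousLinearMap R, fun w => ?_⟩
  refine alternating_congr_mod (formAt σ x) (tangentMap π x : E' →L[ℝ] E).ker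
    (fun w i hi => hσ.horizontal x w i hi) fun i => ?_
  rw [LinearMap.mem_ker]
  change (tangentMap π x : E' →L[ℝ] E) (w i - R ((tangentMap π x : E' →L[ℝ] E) (w i))) = 0
  rw [map_sub, hR, sub_self]

/-- A basic form of a surjective submersion with connected fibres descends to the base. -/
theorem IsBasic.exists_pullback_eq [IsManifold 𝓘(ℝ, E) ∞ N] (hσ : IsBasic E π σ)
    (hS : ∀ x : Q, ∃ S : Straightening E E' F π, x ∈ S.e.source)
    (hsurj : Function.Surjective π) (hconn : ∀ y, IsPreconnected (π ⁻¹' {y})) :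
    ∃ τ : DiffForm E N k, IsSmoothForm τ ∧ pullback π τ = σ := by
  have hfib : ∀ y : N, ∃ τ : E [⋀^Fin k]→L[ℝ] ℝ, ∀ x, π x = y → DescendsTo π σ x τ := by
    intro y
    obtain ⟨x, rfl⟩ := hsurj y
    obtain ⟨S, hx⟩ := hS x
    obtain ⟨τ, hτ⟩ := hσ.exists_descendsTo S hx
    refine ⟨τ, fun x' hx' => ?_⟩
    have := (hconn (π x)).induction₂
      (fun x x' => ∀ τ : E [⋀^Fin k]→L[ℝ] ℝ, DescendsTo π σ x τ ↔ DescendsTo π σ x' τ)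
      (fun x₁ hx₁ => ?_) (fun a b c _ _ _ hab hbc τ => (hab τ).trans (hbc τ))
      (fun a b _ _ hab τ => (hab τ).symm) (x := x) (y := x') rfl hx'
    · exact (this τ).1 hτ
    · obtain ⟨S₁, hS₁⟩ := hS x₁
      filter_upwards [nhdsWithin_le_nhds (hσ.eventually_descendsTo_iff S₁ hS₁),
        self_mem_nhdsWithin] with x₂ h hx₂
      exact h (Eq.trans hx₂ (Eq.symm hx₁))
  choose τ₀ hτ₀ using hfib
  let τ : DiffForm E N k := τ₀
  have hpull : ∀ x, DescendsTo π σ x (formAt τ (π x)) := fun x => hτ₀ _ x rfl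
  refine ⟨τ, fun z y hy => ?_, funext fun x => ContinuousAlternatingMap.ext fun w =>
    (hpull x w).symm⟩
  -- Near a point of the base, `τ` is the pullback of `σ` by a local section.
  obtain ⟨x, hx⟩ := hsurj ((extChartAt 𝓘(ℝ, E) z).symm y)
  obtain ⟨S, hxS⟩ := hS x
  obtain ⟨s, U, hU, hxU, -, hs, hsec⟩ := S.exists_section hxS
  set φ := extChartAt 𝓘(ℝ, E) z with hφ
  have hopen : IsOpen (φ.target ∩ φ.symm ⁻¹' U) :=
    (continuousOn_extChartAt_symm z).isOpen_inter_preimage (isOpen_extChartAt_target z) hU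
  have hsφ : ContMDiffOn 𝓘(ℝ, E) 𝓘(ℝ, E') ∞ (s ∘ φ.symm) (φ.target ∩ φ.symm ⁻¹' U) :=
    hs.comp ((contMDiffOn_extChartAt_symm z).mono Set.inter_subset_left) fun y hy => hy.2
  have hymem : y ∈ φ.target ∩ φ.symm ⁻¹' U := ⟨hy, by rw [Set.mem_preimage, ← hx]; exact hxU⟩
  refine ContDiffAt.contDiffWithinAt (ContDiffAt.congr_of_eventuallyEq
    (hσ.smooth.formAlong hopen hsφ hymem) ?_)
  filter_upwards [hopen.mem_nhds hymem] with y' hy'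
  have hπs : MDifferentiableAt 𝓘(ℝ, E') 𝓘(ℝ, E) π (s (φ.symm y')) := by
    obtain ⟨S', hS'⟩ := hS (s (φ.symm y'))
    exact (S'.contMDiffAt hS').mdifferentiableAt infty_ne_zero
  ext w
  rw [formAlong_apply, hpull, Function.comp_apply]
  refine form_congr τ (hsec _ hy'.2).symm (funext fun i => ?_)
  rw [tangentMap_comp ((hs.contMDiffAt (hU.mem_nhds hy'.2)).mdifferentiableAt infty_ne_zero)
    (extChartAt_symm_mdifferentiableAt z hy'.1),
    Straightening.tangentMap_section hU hs hsec hy'.2 hπs]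
  rfl

end BasicForms

/-! ### Leaves and fibres -/

section Dimension

variable {E : Type*} [NormedAddCommGroup E] [NormedSpace ℝ E]
  {E' : Type*} [NormedAddCommGroup E'] [NormedSpace ℝ E']
  {F : Type*} [NormedAddCommGroup F] [NormedSpace ℝ F]
  {B : Type*} [NormedAddCommGroup B] [NormedSpace ℝ B]
  {L : Type*} [TopologicalSpace L] [ChartedSpace B L]

/-- Smooth maps from a second countable manifold do not raise dimension: the image has Hausdorff
dimension at most that of the source. -/
lemma finrank_le_of_image_mem_nhds [FiniteDimensional ℝ B] [FiniteDimensional ℝ F]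
    [IsManifold 𝓘(ℝ, B) ∞ L] [SecondCountableTopology L] {h : L → F} {W : Set L} (hW : IsOpen W)
    (hh : ContMDiffOn 𝓘(ℝ, B) 𝓘(ℝ, F) ∞ h W) {t : F} (ht : h '' W ∈ 𝓝 t) :
    Module.finrank ℝ F ≤ Module.finrank ℝ B := by
  have hloc : ∀ p ∈ W, ∃ A ∈ 𝓝[W] p, dimH (h '' A) ≤ Module.finrank ℝ B := by
    intro p hp
    set φ := extChartAt 𝓘(ℝ, B) p with hφ
    have hopen : IsOpen (φ.target ∩ φ.symm ⁻¹' W) :=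
      (continuousOn_extChartAt_symm p).isOpen_inter_preimage (isOpen_extChartAt_target p) hW
    have hmem : φ p ∈ φ.target ∩ φ.symm ⁻¹' W :=
      ⟨mem_extChartAt_target p, by rw [Set.mem_preimage, hφ, extChartAt_to_inv]; exact hp⟩
    obtain ⟨r, hr, hball⟩ := Metric.isOpen_iff.1 hopen _ hmem
    have hsm : ContDiffOn ℝ 1 (h ∘ φ.symm) (Metric.ball (φ p) r) := by
      have h1 : ContMDiffOn 𝓘(ℝ, B) 𝓘(ℝ, F) ∞ (h ∘ φ.symm) (Metric.ball (φ p) r) :=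
        hh.comp ((contMDiffOn_extChartAt_symm p).mono fun y hy => (hball hy).1)
          fun y hy => (hball hy).2
      exact (contMDiffOn_iff_contDiffOn.1 h1).of_le (by exact_mod_cast le_top)
    refine ⟨φ.source ∩ φ ⁻¹' Metric.ball (φ p) r, mem_nhdsWithin_of_mem_nhds
      (((continuousOn_extChartAt p).isOpen_inter_preimage (isOpen_extChartAt_source p)
        Metric.isOpen_ball).mem_nhds ⟨mem_extChartAt_source p, Metric.mem_ball_self hr⟩), ?_⟩
    have hsub : h '' (φ.source ∩ φ ⁻¹' Metric.ball (φ p) r) ⊆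
        (h ∘ φ.symm) '' Metric.ball (φ p) r := by
      rintro _ ⟨l, ⟨hl1, hl2⟩, rfl⟩
      exact ⟨φ l, hl2, by rw [Function.comp_apply, φ.left_inv hl1]⟩
    calc dimH (h '' (φ.source ∩ φ ⁻¹' Metric.ball (φ p) r))
        ≤ dimH ((h ∘ φ.symm) '' Metric.ball (φ p) r) := dimH_mono hsub
      _ ≤ dimH (Metric.ball (φ p) r) := hsm.dimH_image_le (convex_ball _ _) subset_rfl
      _ ≤ dimH (Set.univ : Set B) := dimH_mono (Set.subset_univ _)
      _ = Module.finrank ℝ B := Real.dimH_univ_eq_finrank B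
  choose! A hA hdim using hloc
  obtain ⟨T, hTW, hT, hcover⟩ := TopologicalSpace.countable_cover_nhdsWithin hA
  have h1 : dimH (h '' W) ≤ Module.finrank ℝ B := by
    refine (dimH_mono (Set.image_mono hcover)).trans ?_
    rw [Set.image_iUnion₂, dimH_bUnion hT]
    exact iSup₂_le fun p hp => hdim p (hTW hp)
  rw [Real.dimH_of_mem_nhds ht] at h1
  exact_mod_cast h1

/-- The differential of an immersion is injective, as an immersion has a smooth local left
inverse. -/
lemma tangentMap_injective_of_isImmersionAt {Q : Type*} [TopologicalSpace Q] [ChartedSpace E' Q]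
    {j : L → Q} {p : L}
    (h : Manifold.IsImmersionAtOfComplement F 𝓘(ℝ, B) 𝓘(ℝ, E') ∞ j p) :
    Function.Injective (tangentMap j p : B →L[ℝ] E') := by
  let g : Q → L := h.domChart.symm ∘ (fun z => (h.equiv.symm z).1) ∘ h.codChart
  have hcoord : ∀ l ∈ h.domChart.source, (h.equiv.symm (h.codChart (j l))).1 = h.domChart l := by
    intro l hl
    have h0 : h.domChart l ∈ (h.domChart.extend 𝓘(ℝ, B)).target := by
      simpa using h.domChart.map_source hl
    have h1 := h.writtenInCharts h0
    have h2 : h.codChart (j l) = h.equiv (h.domChart l, 0) := by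
      simpa [h.domChart.left_inv hl] using h1
    rw [h2, h.equiv.symm_apply_apply]
  have hleft : ∀ l ∈ h.domChart.source, g (j l) = l := fun l hl => by
    change h.domChart.symm (h.equiv.symm (h.codChart (j l))).1 = l
    rw [hcoord l hl, h.domChart.left_inv hl]
  have hp := h.mem_domChart_source
  have hlin : ContDiff ℝ ∞ (fun z => (h.equiv.symm z).1) := by fun_prop
  have hg : ContMDiffAt 𝓘(ℝ, E') 𝓘(ℝ, B) ∞ g (j p) := by
    have h1 : ContMDiffAt 𝓘(ℝ, B) 𝓘(ℝ, B) ∞ h.domChart.symm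
        (((fun z => (h.equiv.symm z).1) ∘ h.codChart) (j p)) := by
      refine contMDiffAt_symm_of_mem_maximalAtlas h.domChart_mem_maximalAtlas ?_
      rw [Function.comp_apply, hcoord p hp]
      exact h.domChart.map_source hp
    exact h1.comp (j p) (hlin.contMDiff.contMDiffAt.comp (j p)
      (contMDiffAt_of_mem_maximalAtlas h.codChart_mem_maximalAtlas h.mem_codChart_source))
  refine Function.LeftInverse.injective (g := (tangentMap g (j p) : E' →L[ℝ] B)) fun v => ?_
  rw [← tangentMap_comp (hg.mdifferentiableAt infty_ne_zero)
    (h.contMDiffAt.mdifferentiableAt infty_ne_zero), tangentMap_congr (g := id), tangentMap_id]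
  · rfl
  · filter_upwards [h.domChart.open_source.mem_nhds hp] with l hl
    exact hleft l hl

/-- A submersion of finite-dimensional manifolds has a finite-dimensional complement; on an empty
manifold any complement will do. -/
lemma exists_finiteDimensional_complement.{w} {A : Type w} [NormedAddCommGroup A]
    [NormedSpace ℝ A] [FiniteDimensional ℝ A]
    {Q : Type*} [TopologicalSpace Q] [ChartedSpace A Q]
    {N : Type*} [TopologicalSpace N] [ChartedSpace E N] {π : Q → N}
    (hπ : Manifold.IsSubmersion 𝓘(ℝ, A) 𝓘(ℝ, E) ∞ π) :
    ∃ (G : Type w) (_ : NormedAddCommGroup G) (_ : NormedSpace ℝ G), FiniteDimensional ℝ G ∧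
      Manifold.IsSubmersionOfComplement G 𝓘(ℝ, A) 𝓘(ℝ, E) ∞ π := by
  obtain ⟨G, _, _, hG⟩ := hπ
  rcases isEmpty_or_nonempty Q with hQ | ⟨⟨q⟩⟩
  · exact ⟨PUnit, inferInstance, inferInstance, inferInstance, fun q => hQ.elim q⟩
  · have eqv := (hG q).equiv
    exact ⟨G, inferInstance, inferInstance, Module.Finite.of_surjective
      ((LinearMap.snd ℝ E G).comp eqv.toLinearMap) (Prod.snd_surjective.comp eqv.surjective), hG⟩

end Dimension

section Leaves

universe u

variable {E : Type*} [NormedAddCommGroup E] [NormedSpace ℝ E]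
  {E' : Type*} [NormedAddCommGroup E'] [NormedSpace ℝ E']
  {N : Type*} [TopologicalSpace N] [ChartedSpace E N]
  {Q : Type u} [TopologicalSpace Q] [ChartedSpace E' Q] {π : Q → N}
  {D : (q : Q) → Submodule ℝ (TangentSpace 𝓘(ℝ, E') q)}

omit [TopologicalSpace N] in
lemma IsLeafSpaceProjection.surjective (h : IsLeafSpaceProjection D π) :
    Function.Surjective π := by
  intro y
  obtain ⟨k, L, _, _, j, -, -, -, hL, -, -, hrange, -⟩ := (h.1 y).prop
  obtain ⟨l⟩ := hL.toNonempty
  exact ⟨j l, by simpa using hrange.subset ⟨l, rfl⟩⟩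

omit [TopologicalSpace N] in
lemma IsLeafSpaceProjection.isPreconnected_fiber (h : IsLeafSpaceProjection D π) (y : N) :
    IsPreconnected (π ⁻¹' {y}) := by
  obtain ⟨k, L, _, _, j, -, -, -, hL, hj, -, hrange, -⟩ := (h.1 y).prop
  rw [← hrange]
  exact isPreconnected_range hj.contMDiff.continuous

lemma IsLeafSpaceProjection.tangentMap_eq_zero (h : IsLeafSpaceProjection D π)
    (hπ : ContMDiff 𝓘(ℝ, E') 𝓘(ℝ, E) ∞ π) {q : Q} {v : E'} (hv : v ∈ D q) :
    (tangentMap π q : E' →L[ℝ] E) v = 0 := by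
  obtain ⟨k, L, _, _, j, -, -, -, -, hj, -, hrange, hD⟩ := (h.1 (π q)).prop
  obtain ⟨l, rfl⟩ : q ∈ Set.range j := by rw [hrange]; rfl
  rw [← hD l] at hv
  obtain ⟨u, rfl⟩ := hv
  refine (tangentMap_comp (hπ.contMDiffAt.mdifferentiableAt infty_ne_zero)
    (hj.contMDiff.contMDiffAt.mdifferentiableAt infty_ne_zero) u).symm.trans ?_
  have hconst : π ∘ j = fun _ => π (j l) := funext fun l' => by
    simpa using hrange.subset ⟨l', rfl⟩
  rw [hconst]
  have : (tangentMap (fun _ : L => π (j l)) l : EuclideanSpace ℝ (Fin k) →L[ℝ] E) = 0 :=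
    mfderiv_const
  rw [this]; rfl

/-- The tangent space of a leaf is the whole kernel of `dπ`: the leaf, being second countable,
could not cover a fibre of larger dimension. -/
lemma IsLeafSpaceProjection.mem_of_tangentMap_eq_zero {F : Type*} [NormedAddCommGroup F]
    [NormedSpace ℝ F] [FiniteDimensional ℝ E] [FiniteDimensional ℝ E'] [FiniteDimensional ℝ F]
    (h : IsLeafSpaceProjection D π)
    (hπ : Manifold.IsSubmersionOfComplement F 𝓘(ℝ, E') 𝓘(ℝ, E) ∞ π) {q : Q} {v : E'}
    (hv : (tangentMap π q : E' →L[ℝ] E) v = 0) : v ∈ D q := by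
  let T : E' →ₗ[ℝ] E := (tangentMap π q : E' →L[ℝ] E)
  let D' : Submodule ℝ E' := D q
  have hle : D' ≤ LinearMap.ker T := fun w hw => h.tangentMap_eq_zero hπ.contMDiff hw
  suffices hdim : Module.finrank ℝ (LinearMap.ker T) ≤ Module.finrank ℝ D' by
    have := Submodule.eq_of_le_of_finrank_le hle hdim
    change v ∈ D'
    rw [this]
    exact hv
  obtain ⟨S, hq⟩ := exists_straightening (hπ q)
  have eqv := (hπ q).equiv
  have hE' : Module.finrank ℝ E' = Module.finrank ℝ E + Module.finrank ℝ F := by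
    rw [eqv.toLinearEquiv.finrank_eq, Module.finrank_prod]
  have hT : LinearMap.range T = ⊤ := by
    obtain ⟨R, hR⟩ := S.exists_rightInverse hq
    exact LinearMap.range_eq_top.2 fun w => ⟨R w, hR w⟩
  have hker : Module.finrank ℝ (LinearMap.ker T) = Module.finrank ℝ F := by
    have h1 := LinearMap.finrank_range_add_finrank_ker T
    rw [hT, finrank_top] at h1
    omega
  obtain ⟨k, L, _, _, j, _, _, _, _, hj, -, hrange, hD⟩ := (h.1 (π q)).prop
  have hqr : q ∈ Set.range j := by rw [hrange]; rfl
  have hDk : Module.finrank ℝ D' = k := by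
    obtain ⟨l, hl⟩ := hqr
    have hinj := tangentMap_injective_of_isImmersionAt
      (hj.isImmersionOfComplement_complement l)
    let J : EuclideanSpace ℝ (Fin k) →ₗ[ℝ] E' :=
      (tangentMap j l : EuclideanSpace ℝ (Fin k) →L[ℝ] E')
    have hD' : D' = LinearMap.range J := by
      subst hl; exact (hD l).symm
    rw [hD', LinearMap.finrank_range_of_inj (f := J) hinj, finrank_euclideanSpace_fin]
  rw [hker, hDk, ← finrank_euclideanSpace_fin (𝕜 := ℝ) (n := k)]
  refine finrank_le_of_image_mem_nhds (L := L) (h := fun l => (S.e (j l)).2)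
    (W := j ⁻¹' S.e.source) (t := (S.e q).2)
    (S.e.open_source.preimage hj.contMDiff.continuous) ?_ ?_
  · exact contDiff_snd.contMDiff.comp_contMDiffOn
      (S.contMDiffOn_e.comp hj.contMDiff.contMDiffOn subset_rfl)
  · have hcont : Continuous fun t : F => ((S.e q).1, t) := by fun_prop
    filter_upwards [(S.e.open_target.preimage hcont).mem_nhds (S.e.map_source hq)] with t ht
    have hfib : S.e.symm ((S.e q).1, t) ∈ Set.range j := by
      rw [hrange, Set.mem_preimage, S.apply_e_symm ht, ← S.c_apply q hq,
        S.c.left_inv (S.mapsTo q hq)]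
      rfl
    obtain ⟨l, hl⟩ := hfib
    refine ⟨l, ?_, ?_⟩
    · rw [Set.mem_preimage, hl]; exact S.e.map_target ht
    · change (S.e (j l)).2 = t
      rw [hl, S.e.right_inv ht]

end Leaves

/-! ### Reduction of locally conformal symplectic forms -/

section Evaluation

variable {E : Type*} [NormedAddCommGroup E] [NormedSpace ℝ E]
  {E' : Type*} [NormedAddCommGroup E'] [NormedSpace ℝ E']
  {M : Type*} [TopologicalSpace M] [ChartedSpace E M]
  {Q : Type*} [TopologicalSpace Q] [ChartedSpace E' Q]

lemma formAt_swap (σ : DiffForm E M 2) (x : M) (u v : E) :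
    formAt σ x ![u, v] = - formAt σ x ![v, u] :=
  alternating_two_swap _ u v

lemma formAt_pullback_one (f : Q → M) (α : DiffForm E M 1) (q : Q) (u : E') :
    formAt (pullback f α : DiffForm E' Q 1) q ![u] =
      formAt α (f q) ![(tangentMap f q : E' →L[ℝ] E) u] :=
  form_congr α rfl (by funext i; fin_cases i; rfl)

lemma formAt_pullback_two (f : Q → M) (α : DiffForm E M 2) (q : Q) (u v : E') :
    formAt (pullback f α : DiffForm E' Q 2) q ![u, v] =
      formAt α (f q) ![(tangentMap f q : E' →L[ℝ] E) u, (tangentMap f q : E' →L[ℝ] E) v] :=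
  form_congr α rfl (by funext i; fin_cases i <;> rfl)

lemma tangentMap_real_comp {φ : ℝ → ℝ} {g : Q → ℝ} {q : Q}
    (hφ : DifferentiableAt ℝ φ (g q)) (hg : ContMDiff 𝓘(ℝ, E') 𝓘(ℝ, ℝ) ∞ g) (v : E') :
    (tangentMap (φ ∘ g) q : E' →L[ℝ] ℝ) v =
      deriv φ (g q) * (tangentMap g q : E' →L[ℝ] ℝ) v := by
  have h2 : (tangentMap φ (g q) : ℝ →L[ℝ] ℝ) = fderiv ℝ φ (g q) := mfderiv_eq_fderiv
  rw [tangentMap_comp hφ.mdifferentiableAt (hg.contMDiffAt.mdifferentiableAt infty_ne_zero), h2,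
    fderiv_eq_smul_deriv, smul_eq_mul, mul_comm]

lemma formAt_dFun (g : Q → ℝ) (q : Q) (v : E') :
    formAt (dFun g : DiffForm E' Q 1) q ![v] = (tangentMap g q : E' →L[ℝ] ℝ) v := rfl

lemma formAt_funSMul {k : ℕ} (h : Q → ℝ) (σ : DiffForm E' Q k) (q : Q) (w : Fin k → E') :
    formAt (funSMul h σ) q w = h q * formAt σ q w := rfl

lemma formAt_extD_pullback_two [IsManifold 𝓘(ℝ, E) ∞ M] [IsManifold 𝓘(ℝ, E') ∞ Q]
    {f : Q → M} (hf : ContMDiff 𝓘(ℝ, E') 𝓘(ℝ, E) ∞ f)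
    {α : DiffForm E M 2} (hα : IsSmoothForm α) (q : Q) (u v w : E') :
    formAt (extD (pullback f α : DiffForm E' Q 2)) q ![u, v, w] =
      formAt (extD α) (f q) ![(tangentMap f q : E' →L[ℝ] E) u,
        (tangentMap f q : E' →L[ℝ] E) v, (tangentMap f q : E' →L[ℝ] E) w] := by
  rw [extD_pullback_apply hf hα]
  exact form_congr (extD α) rfl (by funext i; fin_cases i <;> rfl)

/-- The characteristic distribution is the kernel of `ι^*Ω`. -/
lemma mem_charDist_iff {Ω : DiffForm E M 2} {ι : Q → M} {q : Q} {v : E'} :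
    v ∈ charDist E' Ω ι q ↔
      ∀ w : E', formAt (pullback ι Ω : DiffForm E' Q 2) q ![v, w] = 0 := by
  simp only [formAt_pullback_two]
  constructor
  · intro h w
    exact h _ ⟨w, rfl⟩
  · rintro h _ ⟨w, rfl⟩
    exact h w

/-- The structure equation `dΩ = ω ∧ Ω` pulls back to a submanifold. -/
lemma IsLCS.extD_pullback [IsManifold 𝓘(ℝ, E) ∞ M] [IsManifold 𝓘(ℝ, E') ∞ Q]
    {Ω : DiffForm E M 2} {lee : DiffForm E M 1} {ι : Q → M}
    (hΩ : IsLCS Ω lee) (hι : ContMDiff 𝓘(ℝ, E') 𝓘(ℝ, E) ∞ ι) (q : Q)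
    (u v w : E') :
    formAt (extD (pullback ι Ω : DiffForm E' Q 2)) q ![u, v, w] =
      formAt (pullback ι lee : DiffForm E' Q 1) q ![u] *
        formAt (pullback ι Ω : DiffForm E' Q 2) q ![v, w] +
      formAt (pullback ι lee : DiffForm E' Q 1) q ![v] *
        formAt (pullback ι Ω : DiffForm E' Q 2) q ![w, u] +
      formAt (pullback ι lee : DiffForm E' Q 1) q ![w] *
        formAt (pullback ι Ω : DiffForm E' Q 2) q ![u, v] := by
  simp only [formAt_extD_pullback_two hι hΩ.smooth_form, formAt_pullback_one, formAt_pullback_two]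
  exact hΩ.lee_eq _ _ _ _

end Evaluation

section Reduction

universe u

variable {E : Type*} [NormedAddCommGroup E] [NormedSpace ℝ E]
  {E' : Type*} [NormedAddCommGroup E'] [NormedSpace ℝ E'] [FiniteDimensional ℝ E']
  {B : Type*} [NormedAddCommGroup B] [NormedSpace ℝ B] [FiniteDimensional ℝ B]
  {F : Type*} [NormedAddCommGroup F] [NormedSpace ℝ F] [FiniteDimensional ℝ F]
  {M : Type*} [TopologicalSpace M] [ChartedSpace E M] [IsManifold 𝓘(ℝ, E) ∞ M]
  {Q : Type u} [TopologicalSpace Q] [ChartedSpace E' Q] [IsManifold 𝓘(ℝ, E') ∞ Q]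
  {N : Type*} [TopologicalSpace N] [ChartedSpace B N] [IsManifold 𝓘(ℝ, B) ∞ N]
  {Ω : DiffForm E M 2} {lee : DiffForm E M 1} {ι : Q → M} {π : Q → N}

omit [FiniteDimensional ℝ B] [FiniteDimensional ℝ F] in
/-- If `π^*τ = f ι^*Ω` for a locally conformal symplectic form `τ` with Lee form `α`, comparing the
exterior derivatives gives `(d log f + ι^*ω - π^*α) ∧ ι^*Ω = 0`. Contracting with a characteristic
vector `v` leaves `(d log f + ι^*ω)(v) = 0`, since `ι^*Ω ≠ 0`. -/
theorem pullback_lee_mem_of_reduction [Nontrivial B]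
    (hΩ : IsLCS Ω lee) (hι : ContMDiff 𝓘(ℝ, E') 𝓘(ℝ, E) ∞ ι)
    (hπ : Manifold.IsSubmersionOfComplement F 𝓘(ℝ, E') 𝓘(ℝ, B) ∞ π)
    (hleaf : IsLeafSpaceProjection (charDist E' Ω ι) π)
    {τ : DiffForm B N 2} {α : DiffForm B N 1} (hτ : IsLCS τ α) {f : Q → ℝ}
    (hf : ContMDiff 𝓘(ℝ, E') 𝓘(ℝ, ℝ) ∞ f) (hpos : ∀ q, 0 < f q)
    (hpull : (pullback π τ : DiffForm E' Q 2) = funSMul f (pullback ι Ω)) :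
    (pullback ι lee : DiffForm E' Q 1) ∈ exactForms E' Q ⊔ vanishingForms (charDist E' Ω ι) := by
  set σ : DiffForm E' Q 2 := pullback ι Ω with hσ
  set l : DiffForm E' Q 1 := pullback ι lee with hl
  have hσs : IsSmoothForm σ := hΩ.smooth_form.pullback hι
  have hls : IsSmoothForm l := hΩ.smooth_lee.pullback hι
  let g : Q → ℝ := (fun t => - Real.log t) ∘ f
  have hg : ContMDiff 𝓘(ℝ, E') 𝓘(ℝ, ℝ) ∞ g := fun q =>
    ((Real.contDiffAt_log.2 (hpos q).ne').neg.contMDiffAt).comp q hf.contMDiffAt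
  refine Submodule.mem_sup.2 ⟨dFun g, ⟨g, hg, rfl⟩, l + (-1 : ℝ) • dFun g,
    ⟨hls.add ((isSmoothForm_dFun hg).smul (-1)), fun q (v : E') hv => ?_⟩, by module⟩
  have hdv : (tangentMap π q : E' →L[ℝ] B) v = 0 := hleaf.tangentMap_eq_zero hπ.contMDiff hv
  have hσv := mem_charDist_iff (v := v).1 hv
  -- Nondegeneracy of `τ` yields vectors on which `σ` does not vanish.
  obtain ⟨a, b, hab⟩ : ∃ a b : E', formAt σ q ![a, b] ≠ 0 := by
    obtain ⟨S, hqS⟩ := exists_straightening (hπ q)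
    obtain ⟨R, hR⟩ := S.exists_rightInverse hqS
    obtain ⟨y, hy⟩ := exists_ne (0 : B)
    by_contra! hzero
    refine hy (hτ.nondegenerate (π q) y fun (z : B) => ?_)
    have h1 : formAt (pullback π τ : DiffForm E' Q 2) q ![R y, R z] = 0 := by
      rw [hpull, formAt_funSMul, hzero, mul_zero]
    rwa [formAt_pullback_two, hR, hR] at h1
  have h1 := formAt_extD_pullback_two hπ.contMDiff hτ.smooth_form q v a b
  have h2 : formAt (extD τ) (π q) ![(tangentMap π q : E' →L[ℝ] B) v,
      (tangentMap π q : E' →L[ℝ] B) a, (tangentMap π q : E' →L[ℝ] B) b] = 0 :=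
    (formAt (extD τ) (π q)).map_coord_zero 0 hdv
  rw [h2, hpull, extD_funSMul_apply hf hσs, hΩ.extD_pullback hι, ← hl, ← hσ, hσv a,
    formAt_swap σ q b v, hσv b] at h1
  have hdg : (tangentMap g q : E' →L[ℝ] ℝ) v = - ((f q)⁻¹ * (tangentMap f q : E' →L[ℝ] ℝ) v) := by
    have hd : HasDerivAt (fun t => - Real.log t) (- (f q)⁻¹) (f q) :=
      (Real.hasDerivAt_log (hpos q).ne').neg
    rw [tangentMap_real_comp hd.differentiableAt hf, hd.deriv, neg_mul]
  change formAt l q ![v] + -1 * formAt (dFun g) q ![v] = 0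
  rw [formAt_dFun, hdg]
  have h3 : ((tangentMap f q : E' →L[ℝ] ℝ) v + f q * formAt l q ![v]) * formAt σ q ![a, b] = 0 := by
    linear_combination h1
  have h4 := (mul_eq_zero.1 h3).resolve_right hab
  have hne := (hpos q).ne'
  field_simp
  linear_combination h4

/-- If `ι^*ω = dg + β` with `β` vanishing on the characteristic foliation, then `β` and
`σ = e^{-g} ι^*Ω` satisfy `dβ = 0` and `dσ = β ∧ σ`, so both are basic; they descend to a Lee form
and a locally conformal symplectic form on the leaf space. -/
theorem exists_reduction_of_pullback_lee_mem
    (hΩ : IsLCS Ω lee) (hι : ContMDiff 𝓘(ℝ, E') 𝓘(ℝ, E) ∞ ι)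
    (hπ : Manifold.IsSubmersionOfComplement F 𝓘(ℝ, E') 𝓘(ℝ, B) ∞ π)
    (hleaf : IsLeafSpaceProjection (charDist E' Ω ι) π)
    (hmem : (pullback ι lee : DiffForm E' Q 1) ∈
      exactForms E' Q ⊔ vanishingForms (charDist E' Ω ι)) :
    ∃ (τ : DiffForm B N 2) (f : Q → ℝ), IsLCSForm τ ∧ ContMDiff 𝓘(ℝ, E') 𝓘(ℝ, ℝ) ∞ f ∧
      (∀ q, 0 < f q) ∧ (pullback π τ : DiffForm E' Q 2) = funSMul f (pullback ι Ω) := by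
  obtain ⟨_, ⟨g, hg, rfl⟩, β, ⟨hβs, hβD⟩, hsum⟩ := Submodule.mem_sup.1 hmem
  set σ₀ : DiffForm E' Q 2 := pullback ι Ω with hσ₀
  set l : DiffForm E' Q 1 := pullback ι lee with hl
  have hσ₀s : IsSmoothForm σ₀ := hΩ.smooth_form.pullback hι
  have hker : ∀ {q : Q} {v : E'}, (tangentMap π q : E' →L[ℝ] B) v = 0 → v ∈ charDist E' Ω ι q :=
    fun hv => hleaf.mem_of_tangentMap_eq_zero hπ hv
  let f : Q → ℝ := (fun t => Real.exp (-t)) ∘ g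
  have hφ : ContDiff ℝ ∞ fun t : ℝ => Real.exp (-t) := by fun_prop
  have hf : ContMDiff 𝓘(ℝ, E') 𝓘(ℝ, ℝ) ∞ f := hφ.contMDiff.comp hg
  have hpos : ∀ q, 0 < f q := fun q => Real.exp_pos _
  have hdf : ∀ (q : Q) (v : E'), (tangentMap f q : E' →L[ℝ] ℝ) v =
      - f q * (tangentMap g q : E' →L[ℝ] ℝ) v := fun q v => by
    have hd : HasDerivAt (fun t : ℝ => Real.exp (-t)) (Real.exp (-g q) * -1) (g q) :=
      (hasDerivAt_neg (g q)).exp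
    rw [tangentMap_real_comp hd.differentiableAt hg, hd.deriv]
    simp only [f, Function.comp_apply]
    ring
  set σ : DiffForm E' Q 2 := funSMul f σ₀ with hσ
  have hσs : IsSmoothForm σ := isSmoothForm_funSMul hf hσ₀s
  have hlβ : ∀ (q : Q) (v : E'), formAt l q ![v] =
      (tangentMap g q : E' →L[ℝ] ℝ) v + formAt β q ![v] := fun q v => by
    rw [← hsum]; rfl
  have hdσ : ∀ (q : Q) (u v w : E'), formAt (extD σ) q ![u, v, w] =
      formAt β q ![u] * formAt σ q ![v, w] + formAt β q ![v] * formAt σ q ![w, u] +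
        formAt β q ![w] * formAt σ q ![u, v] := fun q u v w => by
    rw [hσ, extD_funSMul_apply hf hσ₀s, hΩ.extD_pullback hι, ← hl, ← hσ₀]
    simp only [formAt_funSMul, hdf, hlβ]
    ring
  have hdβ : extD β = 0 := by
    have h1 : extD l = 0 := funext fun q => extD_pullback_eq_zero hι hΩ.smooth_lee hΩ.closed_lee q
    rwa [← hsum, extD_add (isSmoothForm_dFun hg) hβs, extD_dFun hg, zero_add] at h1
  have hβv : ∀ {q : Q} {v : E'}, (tangentMap π q : E' →L[ℝ] B) v = 0 → formAt β q ![v] = 0 :=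
    fun hv => hβD _ _ (hker hv)
  have hσv : ∀ {q : Q} {v : E'} (w : E'), (tangentMap π q : E' →L[ℝ] B) v = 0 →
      formAt σ q ![v, w] = 0 := fun w hv => by
    rw [hσ, formAt_funSMul, mem_charDist_iff.1 (hker hv) w, mul_zero]
  have hβbasic : IsBasic B π β := by
    refine ⟨hβs, fun q w i hi => ?_, fun q w _ => by rw [hdβ]; rfl⟩
    have hw : w = ![w i] := by funext k; rw [Subsingleton.elim k i]; simp
    rw [hw]
    exact hβv hi
  have hσbasic : IsBasic B π σ := by
    refine ⟨hσs, fun q w i hi => ?_, fun q w hw => ?_⟩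
    · have hw : w = ![w 0, w 1] := by funext k; fin_cases k <;> rfl
      rw [hw]
      fin_cases i
      · exact hσv _ hi
      · rw [formAt_swap, hσv (v := w 1) _ hi, neg_zero]
    · have hw' : w = ![w 0, w 1, w 2] := by funext k; fin_cases k <;> rfl
      rw [hw', hdσ, hβv hw, formAt_swap σ q (w 2) (w 0), hσv _ hw, hσv _ hw]
      ring
  have hS := fun q => exists_straightening (hπ q)
  obtain ⟨τ, hτs, hτ⟩ := hσbasic.exists_pullback_eq hS hleaf.surjective hleaf.isPreconnected_fiber
  obtain ⟨α, hαs, hα⟩ := hβbasic.exists_pullback_eq hS hleaf.surjective hleaf.isPreconnected_fiber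
  -- Every tangent vector of `N` is the projection of one of `Q`.
  have hlift : ∀ y : N, ∃ (q : Q) (R : B →L[ℝ] E'), π q = y ∧
      ∀ v, (tangentMap π q : E' →L[ℝ] B) (R v) = v := fun y => by
    obtain ⟨q, hq⟩ := hleaf.surjective y
    obtain ⟨S, hqS⟩ := hS q
    obtain ⟨R, hR⟩ := S.exists_rightInverse hqS
    exact ⟨q, R, hq, hR⟩
  refine ⟨τ, f, ⟨α, hτs, fun y (v : B) hv => ?_, hαs, fun y => ?_,
    fun y (u v w : B) => ?_⟩, hf, hpos, hτ⟩
  · obtain ⟨q, R, rfl, hR⟩ := hlift y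
    have hmem : R v ∈ charDist E' Ω ι q := mem_charDist_iff.2 fun w => by
      have h1 : formAt σ q ![R v, w] = 0 := by
        rw [← hτ, formAt_pullback_two, hR]
        exact hv _
      exact (mul_eq_zero.1 h1).resolve_left (hpos q).ne'
    rw [← hR v]
    exact hleaf.tangentMap_eq_zero hπ.contMDiff hmem
  · obtain ⟨q, R, rfl, hR⟩ := hlift y
    refine ContinuousAlternatingMap.ext fun (w : Fin 2 → B) => ?_
    have h1 := extD_pullback_apply hπ.contMDiff hαs q (fun i => R (w i))
    rw [hα, hdβ] at h1
    simp only [hR] at h1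
    exact h1.symm
  · obtain ⟨q, R, rfl, hR⟩ := hlift y
    have h1 := hdσ q (R u) (R v) (R w)
    rw [← hτ, ← hα, formAt_extD_pullback_two hπ.contMDiff hτs] at h1
    simp only [formAt_pullback_one, formAt_pullback_two, hR] at h1
    exact h1

end Reduction

end LCSReduction
end

open LCSReduction
theorem mainTheorem1 {n r d : ℕ} (hn : 1 < n)
    {M : Type*} [TopologicalSpace M] [ChartedSpace (EuclideanSpace ℝ (Fin (2 * n))) M]
    [IsManifold (𝓡 (2 * n)) ∞ M] [T2Space M] [SecondCountableTopology M]
    (Ω : DiffForm (EuclideanSpace ℝ (Fin (2 * n))) M 2)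
    (lee : DiffForm (EuclideanSpace ℝ (Fin (2 * n))) M 1)
    (hΩ : IsLCS Ω lee)
    {Q : Type*} [TopologicalSpace Q] [ChartedSpace (EuclideanSpace ℝ (Fin r)) Q]
    [IsManifold (𝓡 r) ∞ Q] [T2Space Q] [SecondCountableTopology Q]
    (ι : Q → M) (hι : Manifold.IsImmersion (𝓡 r) (𝓡 (2 * n)) ∞ ι)
    (hι_inj : Function.Injective ι)
    (hrank : ∃ k : ℕ, ∀ q : Q, Module.finrank ℝ (charDist (EuclideanSpace ℝ (Fin r)) Ω ι q) = k)
    {N : Type*} [TopologicalSpace N] [ChartedSpace (EuclideanSpace ℝ (Fin d)) N]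
    [IsManifold (𝓡 d) ∞ N] [T2Space N] [SecondCountableTopology N]
    (hd : 2 < d)
    (π : Q → N) (hπ_leaf : IsLeafSpaceProjection (charDist (EuclideanSpace ℝ (Fin r)) Ω ι) π)
    (hπ : Manifold.IsSubmersion (𝓡 r) (𝓡 d) ∞ π) :
    (∃ (τ : DiffForm (EuclideanSpace ℝ (Fin d)) N 2) (f : Q → ℝ),
      IsLCSForm τ ∧ ContMDiff (𝓡 r) 𝓘(ℝ, ℝ) ∞ f ∧ (∀ q : Q, 0 < f q) ∧
      ∀ q : Q, (pullback π τ : DiffForm (EuclideanSpace ℝ (Fin r)) Q 2) q =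
        f q • (pullback ι Ω : DiffForm (EuclideanSpace ℝ (Fin r)) Q 2) q) ↔
    foliatedClass (charDist (EuclideanSpace ℝ (Fin r)) Ω ι) (pullback ι lee)
      (hΩ.pullback_lee_mem hι (charDist (EuclideanSpace ℝ (Fin r)) Ω ι)) = 0 := by
  obtain ⟨F, _, _, _, hπF⟩ := exists_finiteDimensional_complement hπ
  have hB : Nontrivial (EuclideanSpace ℝ (Fin d)) :=
    Module.nontrivial_of_finrank_pos (R := ℝ) (by rw [finrank_euclideanSpace_fin]; omega)
  rw [foliatedClass, Submodule.Quotient.mk_eq_zero, Submodule.mem_comap]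
  constructor
  · rintro ⟨τ, f, ⟨α, hτ⟩, hf, hpos, hpull⟩
    exact pullback_lee_mem_of_reduction hΩ hι.contMDiff hπF hπ_leaf hτ hf hpos (funext hpull)
  · intro hmem
    obtain ⟨τ, f, hτ, hf, hpos, hpull⟩ :=
      exists_reduction_of_pullback_lee_mem hΩ hι.contMDiff hπF hπ_leaf hmem
    exact ⟨τ, f, hτ, hf, hpos, fun q => congrFun hpull q⟩
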